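/- Let $K$ be a tempered distribution on $\mathbb R\times\mathbb R$ that is bi-even, i.e. invariant under $y\mapsto -y$ and under $z\mapsto -z$. For a tempered distribution $L$ on $\mathbb R^n\times\mathbb R^n$, let $T_L$ be the bilinear operator from $\mathcal S(\mathbb R^n)\times\mathcal S(\mathbb R^n)$ to $\mathcal S'(\mathbb R^n)$ with kernel $L$, that is, $$\langle T_L(f,g),h\rangle=\int_{\mathbb R^{3n}} L(y,z)\,f(x-y)\,g(x-z)\,h(x)\,dx\,dy\,dz ,$$ understood as $L$ applied to the Schwartz function $(y,z)\mapsto\int f(x-y)g(x-z)h(x)\,dx$. We say that $T_L$ is a *bilinear Fourier multiplier of Marcinkiewicz type* on $\mathbb R^n$ if its symbol $m=\widehat L$ is a function which is $C^\infty$ on $\{(\xi,\eta):\xi\ne0,\ \eta\neq 0\}$ and satisfies, for all multi-indices $\alpha,\beta$, $$\sup_{\xi\ne0,\ \eta\neq 0}|\xi|^{|\alpha|}|\eta|^{|\beta|}\left|\partial_\xi^\alpha\partial_\eta^\beta m(\xi,\eta)\right|<\infty ,$$ and, for all $f,g,h\in\mathcal S(\mathbb R^n)$, $$\langle T_L(f,g),h\rangle=\int_{\mathbb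 R^{2n}} m(\xi,\eta)\,\widehat f(\xi)\,\widehat g(\eta)\,\check h(\xi+\eta)\,d\xi\,d\eta ,\qquad \check h(\zeta)=\int h(x)e^{2\pi i x\cdot\zeta}dx .$$ For $n\ge2$ let $\widetilde K$ be the tempered distribution $\widetilde K(y,z)=(|y||z|)^{-(n-1)}K(|y|,|z|)$ on $\mathbb R^n\times\mathbb R^n$, defined through polar coordinates by $$\langle\widetilde K,\varphi\rangle=\tfrac14\,\langle K,\Phi\rangle,\qquad \Phi(r,s)=\int_{S^{n-1}}\int_{S^{n-1}}\varphi(r\theta,s\theta')\,d\sigma(\theta)\,d\sigma(\theta')\quad (r,s\in\mathbb R),$$ where $\sigma$ is surface measure; when $K$ is a bi-even locally integrable function, this is integration against the function $(|y||z|)^{-(n-1)}K(|y|,|z|)$. If $T_K$ is a bilinear Fourier multiplier of Marcinkiewicz type on $\mathbb R$, then for every odd integer $n\ge3$ the operator $T_{\widetilde K}$ is a bilinear Fourier multiplier of Marcinkiewicz type on $\mathbb R^n$. -/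

import Mathlib

open SchwartzMap

namespace BilinearMultiplier

open MeasureTheory FourierTransform
open scoped ContDiff

set_option linter.unusedSectionVars false

noncomputable section

theorem hasFDerivAt_integral_aux {A E X Y : Type*} [MeasurableSpace A] {μ : Measure A}
    [NormedAddCommGroup E] [NormedSpace ℝ E] [NormedAddCommGroup X] [NormedSpace ℝ X]
    [CompleteSpace X] [NormedAddCommGroup Y] [NormedSpace ℝ Y] [CompleteSpace Y]
    (Q : X →L[ℝ] (E →L[ℝ] Y)) (F : A → E → Y) (D : A → E → X)
    (hF : ∀ x, AEStronglyMeasurable (fun a => F a x) μ)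
    (hFi : ∀ x, Integrable (fun a => F a x) μ) (hDi : ∀ x, Integrable (fun a => D a x) μ)
    (b : A → ℝ) (hb : Integrable b μ) (hbd : ∀ a x, ‖D a x‖ ≤ b a)
    (hder : ∀ a x, HasFDerivAt (F a) (Q (D a x)) x) (x : E) :
    HasFDerivAt (fun y => ∫ a, F a y ∂μ) (Q (∫ a, D a x ∂μ)) x := by
  rw [← Q.integral_comp_comm (hDi x)]
  exact hasFDerivAt_integral_of_dominated_of_fderiv_le (𝕜 := ℝ) (s := Set.univ)
    (F := fun y a => F a y) (F' := fun y a => Q (D a y)) (bound := fun a => ‖Q‖ * b a) Filter.univ_mem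
    (Filter.Eventually.of_forall hF) (hFi x)
    (Q.continuous.comp_aestronglyMeasurable (hDi x).aestronglyMeasurable)
    (Filter.Eventually.of_forall fun a y _ => (Q.le_opNorm _).trans (by gcongr; exact hbd a y))
    (hb.const_mul _)
    (Filter.Eventually.of_forall fun a y _ => hder a y)

theorem hasFTaylorSeriesUpTo_integral {A E : Type*} [MeasurableSpace A] {μ : Measure A}
    [NormedAddCommGroup E] [NormedSpace ℝ E] (G : A → E → ℂ) (hG : ∀ a, ContDiff ℝ ∞ (G a))
    (hm : ∀ l x, AEStronglyMeasurable (fun a => iteratedFDeriv ℝ l (G a) x) μ)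
    (b : ℕ → A → ℝ) (hb : ∀ l, Integrable (b l) μ)
    (hbd : ∀ l a x, ‖iteratedFDeriv ℝ l (G a) x‖ ≤ b l a) :
    HasFTaylorSeriesUpTo ∞ (fun x => ∫ a, G a x ∂μ)
      (fun x l => ∫ a, iteratedFDeriv ℝ l (G a) x ∂μ) := by
  have hint : ∀ l x, Integrable (fun a => iteratedFDeriv ℝ l (G a) x) μ := fun l x =>
    (hb l).mono' (hm l x) (Filter.Eventually.of_forall fun a => hbd l a x)
  have hder : ∀ (l : ℕ) (x : E), HasFDerivAt (fun y => ∫ a, iteratedFDeriv ℝ l (G a) y ∂μ)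
      (∫ a, iteratedFDeriv ℝ (l + 1) (G a) x ∂μ).curryLeft x := by
    intro l x
    let Q := (continuousMultilinearCurryLeftEquiv ℝ (fun _ : Fin (l + 1) => E) ℂ)
    exact hasFDerivAt_integral_aux (Q.toContinuousLinearEquiv : _ →L[ℝ] _)
      (fun a y => iteratedFDeriv ℝ l (G a) y)
      (fun a y => iteratedFDeriv ℝ (l + 1) (G a) y) (hm l) (hint l) (hint (l + 1)) (b (l + 1))
      (hb (l + 1)) (fun a y => hbd (l + 1) a y)
      (fun a y => (hG a).ftaylorSeries.fderiv l (by exact_mod_cast ENat.natCast_lt_top l) y) x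
  refine ⟨fun x => ?_, fun l _ x => hder l x, fun l _ => ?_⟩
  · have h0 := (continuousMultilinearCurryFin0 ℝ E ℂ).toContinuousLinearEquiv.toContinuousLinearMap.integral_comp_comm
      (hint 0 x)
    change (continuousMultilinearCurryFin0 ℝ E ℂ) _ = _
    refine h0.symm.trans ?_
    simp
  · exact continuous_iff_continuousAt.2 fun x => (hder l x).continuousAt

/-- The weighted average `x ↦ ∫ h(a) φ(c(a) + L(a) x) dμ(a)` of affine isometric copies of `φ`. -/
def affineAverage {A E E' : Type*} [MeasurableSpace A]
    [NormedAddCommGroup E] [NormedSpace ℝ E] [NormedAddCommGroup E'] [NormedSpace ℝ E']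
    (μ : Measure A) (L : A → E →ₗᵢ[ℝ] E') (c : A → E') (h : A → ℂ) (φ : E' → ℂ) (x : E) : ℂ :=
  ∫ a, h a * φ (c a + L a x) ∂μ

section average

variable {A E E' : Type*} [MeasurableSpace A] [TopologicalSpace A] [OpensMeasurableSpace A]
  [SecondCountableTopology A]
  [NormedAddCommGroup E] [NormedSpace ℝ E] [NormedAddCommGroup E'] [NormedSpace ℝ E']
  {μ : Measure A} {L : A → E →ₗᵢ[ℝ] E'} {c : A → E'} {h : A → ℂ}

theorem iteratedFDeriv_affine (φ : 𝓢(E', ℂ)) (a : A) (l : ℕ) (x : E) :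
    iteratedFDeriv ℝ l (fun x => h a * φ (c a + L a x)) x =
      h a • (iteratedFDeriv ℝ l φ (c a + L a x)).compContinuousLinearMap
        (fun _ => (L a).toContinuousLinearMap) := by
  have hs : ContDiff ℝ l (fun y => φ (c a + y)) :=
    (φ.smooth l).comp (contDiff_const.add contDiff_id)
  have h1 := (L a).toContinuousLinearMap.iteratedFDeriv_comp_right hs x le_rfl
  rw [iteratedFDeriv_comp_add_left] at h1
  change iteratedFDeriv ℝ l (h a • ((fun y => φ (c a + y)) ∘ (L a).toContinuousLinearMap)) x = _
  rw [iteratedFDeriv_const_smul_apply, h1]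
  · rfl
  · exact (hs.comp (L a).toContinuousLinearMap.contDiff).contDiffAt

theorem norm_iteratedFDeriv_affine_le (φ : 𝓢(E', ℂ)) (a : A) (l : ℕ) (x : E) :
    ‖iteratedFDeriv ℝ l (fun x => h a * φ (c a + L a x)) x‖ ≤
      ‖h a‖ * ‖iteratedFDeriv ℝ l φ (c a + L a x)‖ := by
  rw [iteratedFDeriv_affine, norm_smul]
  gcongr
  refine (ContinuousMultilinearMap.norm_compContinuousLinearMap_le _ _).trans ?_
  refine mul_le_of_le_one_right (norm_nonneg _) ?_
  exact Finset.prod_le_one (fun _ _ => norm_nonneg _) fun _ _ => (L a).norm_toContinuousLinearMap_le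

theorem continuous_iteratedFDeriv_affine
    (hL : Continuous fun a => (L a).toContinuousLinearMap) (hc : Continuous c) (hh : Continuous h)
    (φ : 𝓢(E', ℂ)) (l : ℕ) (x : E) :
    Continuous fun a => iteratedFDeriv ℝ l (fun x => h a * φ (c a + L a x)) x := by
  simp_rw [iteratedFDeriv_affine]
  refine hh.smul ?_
  have h1 : Continuous fun a => ContinuousMultilinearMap.compContinuousLinearMapContinuousMultilinear
      ℝ (fun _ : Fin l => E) (fun _ : Fin l => E') ℂ (fun _ => (L a).toContinuousLinearMap) :=
    (ContinuousMultilinearMap.cont _).comp (continuous_pi fun _ => hL)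
  have h2 : Continuous fun a => iteratedFDeriv ℝ l φ (c a + L a x) := by
    refine ((φ.smooth l).continuous_iteratedFDeriv le_rfl).comp (hc.add ?_)
    exact hL.clm_apply continuous_const
  exact h1.clm_apply h2

/-- The hypotheses under which `affineAverage` maps Schwartz functions to Schwartz functions. -/
structure Admissible (μ : Measure A) (L : A → E →ₗᵢ[ℝ] E') (c : A → E') (h : A → ℂ) : Prop where
  contL : Continuous fun a => (L a).toContinuousLinearMap
  contc : Continuous c
  conth : Continuous h
  integrable : ∀ k : ℕ, Integrable (fun a => ‖h a‖ * (1 + ‖c a‖) ^ k) μ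

theorem affine_bound (φ : 𝓢(E', ℂ)) (a : A) (k l : ℕ) (x : E) :
    ‖x‖ ^ k * ‖iteratedFDeriv ℝ l (fun x => h a * φ (c a + L a x)) x‖ ≤
      (‖h a‖ * (1 + ‖c a‖) ^ k) *
        (2 ^ k * ((Finset.Iic (k, l)).sup (schwartzSeminormFamily ℂ E' ℂ)) φ) := by
  set w := c a + L a x with hw
  have hx : ‖x‖ ≤ (1 + ‖c a‖) * (1 + ‖w‖) := by
    have : ‖x‖ ≤ ‖c a‖ + ‖w‖ := by
      rw [← (L a).norm_map x]
      have : L a x = w - c a := by rw [hw]; abel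
      rw [this]
      exact (norm_sub_le _ _).trans (by rw [add_comm])
    nlinarith [norm_nonneg (c a), norm_nonneg w, mul_nonneg (norm_nonneg (c a)) (norm_nonneg w)]
  have h2 : (1 + ‖w‖) ^ k * ‖iteratedFDeriv ℝ l φ w‖ ≤
      2 ^ k * ((Finset.Iic (k, l)).sup (schwartzSeminormFamily ℂ E' ℂ)) φ :=
    one_add_le_sup_seminorm_apply (𝕜 := ℂ) (m := (k, l)) le_rfl le_rfl φ w
  calc _ ≤ ((1 + ‖c a‖) * (1 + ‖w‖)) ^ k * (‖h a‖ * ‖iteratedFDeriv ℝ l φ w‖) := by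
        gcongr
        exact norm_iteratedFDeriv_affine_le φ a l x
    _ = (‖h a‖ * (1 + ‖c a‖) ^ k) * ((1 + ‖w‖) ^ k * ‖iteratedFDeriv ℝ l φ w‖) := by
        rw [mul_pow]; ring
    _ ≤ _ := by gcongr

theorem affineAverage_taylor (H : Admissible μ L c h) (φ : 𝓢(E', ℂ)) :
    HasFTaylorSeriesUpTo ∞ (affineAverage μ L c h φ)
      (fun x l => ∫ a, iteratedFDeriv ℝ l (fun x => h a * φ (c a + L a x)) x ∂μ) := by
  refine hasFTaylorSeriesUpTo_integral (fun a x => h a * φ (c a + L a x)) (fun a => ?_)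
    (fun l x => (continuous_iteratedFDeriv_affine H.contL H.contc H.conth φ l x).aestronglyMeasurable)
    (fun l a => (‖h a‖ * (1 + ‖c a‖) ^ 0) *
        (2 ^ 0 * ((Finset.Iic (0, l)).sup (schwartzSeminormFamily ℂ E' ℂ)) φ))
    (fun l => (H.integrable 0).mul_const _) (fun l a x => ?_)
  · exact contDiff_const.mul
      ((φ.smooth ⊤).comp (contDiff_const.add (L a).toContinuousLinearMap.contDiff))
  · simpa using affine_bound (h := h) (c := c) (L := L) φ a 0 l x

theorem contDiff_affineAverage (H : Admissible μ L c h) (φ : 𝓢(E', ℂ)) :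
    ContDiff ℝ ∞ (affineAverage μ L c h φ) :=
  (affineAverage_taylor H φ).contDiff

theorem affineAverage_bound (H : Admissible μ L c h) (φ : 𝓢(E', ℂ)) (k l : ℕ) (x : E) :
    ‖x‖ ^ k * ‖iteratedFDeriv ℝ l (affineAverage μ L c h φ) x‖ ≤
      (∫ a, ‖h a‖ * (1 + ‖c a‖) ^ k ∂μ) *
        (2 ^ k * ((Finset.Iic (k, l)).sup (schwartzSeminormFamily ℂ E' ℂ)) φ) := by
  rw [← (affineAverage_taylor H φ).eq_iteratedFDeriv (m := l) (by exact_mod_cast le_top) x,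
    ← integral_mul_const]
  have : ‖x‖ ^ k * ‖∫ a, iteratedFDeriv ℝ l (fun x => h a * φ (c a + L a x)) x ∂μ‖ ≤
      ∫ a, ‖x‖ ^ k * ‖iteratedFDeriv ℝ l (fun x => h a * φ (c a + L a x)) x‖ ∂μ := by
    rw [integral_const_mul]
    gcongr
    exact norm_integral_le_integral_norm _
  refine this.trans (integral_mono_of_nonneg (Filter.Eventually.of_forall fun a => by positivity)
    ((H.integrable k).mul_const _) (Filter.Eventually.of_forall fun a => affine_bound φ a k l x))

theorem integrable_affine (H : Admissible μ L c h) (φ : 𝓢(E', ℂ)) (x : E) :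
    Integrable (fun a => h a * φ (c a + L a x)) μ := by
  refine ((H.integrable 0).mul_const (SchwartzMap.seminorm ℂ 0 0 φ)).mono' ?_
    (Filter.Eventually.of_forall fun a => ?_)
  · refine (H.conth.mul (φ.continuous.comp (H.contc.add ?_))).aestronglyMeasurable
    exact H.contL.clm_apply continuous_const
  · rw [norm_mul, pow_zero, mul_one]
    gcongr
    exact norm_le_seminorm ℂ φ _

end average

section tensor

variable {V : Type*} [NormedAddCommGroup V] [InnerProductSpace ℝ V]

theorem contDiff_tensor (f g : 𝓢(V, ℂ)) (n : ℕ∞) :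
    ContDiff ℝ n (fun p : WithLp 2 (V × V) => f p.fst * g p.snd) :=
  ((f.smooth n).comp (WithLp.fstL 2 ℝ V V).contDiff).mul
    ((g.smooth n).comp (WithLp.sndL 2 ℝ V V).contDiff)

/-- The tensor product `(f ⊗ g)(y, z) = f(y) g(z)` of two Schwartz functions. -/
def tensor (f g : 𝓢(V, ℂ)) : 𝓢(WithLp 2 (V × V), ℂ) where
  toFun p := f p.fst * g p.snd
  smooth' := contDiff_tensor f g ⊤
  decay' k l := by
    set Sf := fun i => 2 ^ k * ((Finset.Iic (k, i)).sup (schwartzSeminormFamily ℂ V ℂ)) f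
    set Sg := fun i => 2 ^ k * ((Finset.Iic (k, i)).sup (schwartzSeminormFamily ℂ V ℂ)) g
    refine ⟨∑ i ∈ Finset.range (l + 1), (l.choose i : ℝ) * Sf i * Sg (l - i), fun p => ?_⟩
    have hf1 : ∀ i, ‖iteratedFDeriv ℝ i (fun p : WithLp 2 (V × V) => f p.fst) p‖ ≤
        ‖iteratedFDeriv ℝ i f p.fst‖ := by
      intro i
      have h := (WithLp.fstL 2 ℝ V V).iteratedFDeriv_comp_right (f.smooth i) p le_rfl
      change ‖iteratedFDeriv ℝ i (f ∘ WithLp.fstL 2 ℝ V V) p‖ ≤ _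
      rw [h]
      refine (ContinuousMultilinearMap.norm_compContinuousLinearMap_le _ _).trans ?_
      refine mul_le_of_le_one_right (norm_nonneg _) ?_
      refine Finset.prod_le_one (fun _ _ => norm_nonneg _) fun _ _ => ?_
      refine ContinuousLinearMap.opNorm_le_bound _ zero_le_one fun q => ?_
      rw [one_mul]; exact WithLp.norm_fst_le V q
    have hg1 : ∀ i, ‖iteratedFDeriv ℝ i (fun p : WithLp 2 (V × V) => g p.snd) p‖ ≤
        ‖iteratedFDeriv ℝ i g p.snd‖ := by
      intro i
      have h := (WithLp.sndL 2 ℝ V V).iteratedFDeriv_comp_right (g.smooth i) p le_rfl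
      change ‖iteratedFDeriv ℝ i (g ∘ WithLp.sndL 2 ℝ V V) p‖ ≤ _
      rw [h]
      refine (ContinuousMultilinearMap.norm_compContinuousLinearMap_le _ _).trans ?_
      refine mul_le_of_le_one_right (norm_nonneg _) ?_
      refine Finset.prod_le_one (fun _ _ => norm_nonneg _) fun _ _ => ?_
      refine ContinuousLinearMap.opNorm_le_bound _ zero_le_one fun q => ?_
      rw [one_mul]; exact WithLp.norm_snd_le V q
    have hmul := norm_iteratedFDeriv_mul_le
      (f := fun p : WithLp 2 (V × V) => f p.fst) (g := fun p : WithLp 2 (V × V) => g p.snd)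
      (N := ∞) ((f.smooth ⊤).comp (WithLp.fstL 2 ℝ V V).contDiff)
      ((g.smooth ⊤).comp (WithLp.sndL 2 ℝ V V).contDiff) p (n := l) (by exact_mod_cast le_top)
    have hp : ‖p‖ ≤ (1 + ‖p.fst‖) * (1 + ‖p.snd‖) := by
      have h1 : ‖p‖ ≤ ‖p.fst‖ + ‖p.snd‖ := by
        rw [WithLp.prod_norm_eq_of_L2]
        refine Real.sqrt_le_iff.2 ⟨by positivity, ?_⟩
        nlinarith [mul_nonneg (norm_nonneg p.fst) (norm_nonneg p.snd)]
      nlinarith [norm_nonneg p.fst, norm_nonneg p.snd,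
        mul_nonneg (norm_nonneg p.fst) (norm_nonneg p.snd)]
    calc _ ≤ ((1 + ‖p.fst‖) * (1 + ‖p.snd‖)) ^ k * ∑ i ∈ Finset.range (l + 1),
          (l.choose i : ℝ) * ‖iteratedFDeriv ℝ i f p.fst‖ *
            ‖iteratedFDeriv ℝ (l - i) g p.snd‖ := by
          gcongr
          refine hmul.trans ?_
          gcongr with i _
          · exact hf1 i
          · exact hg1 (l - i)
      _ = ∑ i ∈ Finset.range (l + 1), (l.choose i : ℝ) *
          ((1 + ‖p.fst‖) ^ k * ‖iteratedFDeriv ℝ i f p.fst‖) *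
            ((1 + ‖p.snd‖) ^ k * ‖iteratedFDeriv ℝ (l - i) g p.snd‖) := by
          rw [mul_pow, Finset.mul_sum]
          refine Finset.sum_congr rfl fun i _ => by ring
      _ ≤ _ := by
          gcongr with i _
          · exact one_add_le_sup_seminorm_apply (𝕜 := ℂ) (m := (k, i)) le_rfl le_rfl f p.fst
          · exact one_add_le_sup_seminorm_apply (𝕜 := ℂ) (m := (k, l - i)) le_rfl le_rfl g p.snd

@[simp]
theorem tensor_apply (f g : 𝓢(V, ℂ)) (p : WithLp 2 (V × V)) :
    tensor f g p = f p.fst * g p.snd := rfl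

end tensor

section sphere

variable (V : Type*) [NormedAddCommGroup V] [InnerProductSpace ℝ V] [FiniteDimensional ℝ V]
  [MeasurableSpace V] [BorelSpace V]

/-- The isometry `(r, s) ↦ (r θ, s θ')` for unit vectors `θ`, `θ'`. -/
def rayPair {V : Type*} [NormedAddCommGroup V] [InnerProductSpace ℝ V]
    (a : Metric.sphere (0 : V) 1 × Metric.sphere (0 : V) 1) :
    WithLp 2 (ℝ × ℝ) →ₗᵢ[ℝ] WithLp 2 (V × V) where
  toFun q := WithLp.toLp 2 (q.fst • (a.1 : V), q.snd • (a.2 : V))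
  map_add' q q' := by simp [add_smul, ← WithLp.toLp_add]
  map_smul' t q := by simp [mul_smul, ← WithLp.toLp_smul]
  norm_map' q := by
    have h1 : ‖(a.1 : V)‖ = 1 := by simp
    have h2 : ‖(a.2 : V)‖ = 1 := by simp
    change ‖WithLp.toLp 2 (q.fst • (a.1 : V), q.snd • (a.2 : V))‖ = ‖q‖
    simp [WithLp.prod_norm_eq_of_L2, norm_smul, h1, h2]

/-- The surface measure on the product of two unit spheres. -/
abbrev spherePairMeasure : Measure (Metric.sphere (0 : V) 1 × Metric.sphere (0 : V) 1) :=
  (volume : Measure V).toSphere.prod (volume : Measure V).toSphere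

theorem admissible_sphere :
    Admissible (spherePairMeasure V) (rayPair (V := V)) (fun _ => 0) (fun _ => 1) where
  contL := by
    rw [continuous_clm_apply]
    intro q
    refine (WithLp.prod_continuous_toLp 2 V V).comp ?_
    fun_prop
  contc := continuous_const
  conth := continuous_const
  integrable k := by simp

/-- The operator `φ ↦ ((r, s) ↦ ∫∫ φ(r θ, s θ') dσ(θ) dσ(θ'))`, where `σ` is the surface measure of
the unit sphere of `V`, from Schwartz functions on `V × V` to Schwartz functions on `ℝ × ℝ`. -/
def sphereIntegral : 𝓢(WithLp 2 (V × V), ℂ) →L[ℂ] 𝓢(WithLp 2 (ℝ × ℝ), ℂ) :=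
  SchwartzMap.mkCLM
    (fun φ q => affineAverage (spherePairMeasure V) rayPair (fun _ => 0) (fun _ => 1) φ q)
    (fun φ ψ q => by
      simp only [affineAverage, add_apply, mul_add]
      exact integral_add (integrable_affine (admissible_sphere V) φ q)
        (integrable_affine (admissible_sphere V) ψ q))
    (fun t φ q => by
      simp only [affineAverage, smul_apply, smul_eq_mul, RingHom.id_apply]
      rw [← integral_const_mul]
      refine integral_congr_ae (Filter.Eventually.of_forall fun a => by ring_nf))
    (fun φ => contDiff_affineAverage (admissible_sphere V) φ)
    (fun n => ⟨Finset.Iic n, (∫ _a, ‖(1 : ℂ)‖ * (1 + ‖(0 : WithLp 2 (V × V))‖) ^ n.1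
        ∂(spherePairMeasure V)) * 2 ^ n.1, by positivity, fun φ q => by
      rw [mul_assoc]
      exact affineAverage_bound (admissible_sphere V) φ n.1 n.2 q⟩)

theorem sphereIntegral_apply (φ : 𝓢(WithLp 2 (V × V), ℂ)) (q : WithLp 2 (ℝ × ℝ)) :
    sphereIntegral V φ q = ∫ θ : Metric.sphere (0 : V) 1, ∫ θ' : Metric.sphere (0 : V) 1,
      φ (WithLp.toLp 2 (q.fst • (θ : V), q.snd • (θ' : V)))
        ∂(volume : Measure V).toSphere ∂(volume : Measure V).toSphere := by
  have h := integrable_affine (admissible_sphere V) φ q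
  have h2 := integral_prod _ h
  simp only [one_mul, zero_add] at h2
  change ∫ a, (1 : ℂ) * φ (0 + rayPair a q) ∂(spherePairMeasure V) = _
  simp only [one_mul, zero_add]
  exact h2

end sphere

section kernelTest

variable {V : Type*} [NormedAddCommGroup V] [InnerProductSpace ℝ V] [FiniteDimensional ℝ V]
  [MeasurableSpace V] [BorelSpace V]

theorem weight_bound (k : ℕ) : ∃ s : Finset (ℕ × ℕ), ∃ C : ℝ, 0 ≤ C ∧ ∀ h : 𝓢(V, ℂ),
    Integrable (fun x => ‖h x‖ * (1 + ‖WithLp.toLp 2 (x, x)‖) ^ k) ∧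
    ∫ x, ‖h x‖ * (1 + ‖WithLp.toLp 2 (x, x)‖) ^ k ≤
      C * (s.sup (schwartzSeminormFamily ℂ V ℂ)) h := by
  set N := Module.finrank ℝ V + 1 with hN
  have hI : Integrable (fun x : V => (1 + ‖x‖) ^ (-(N : ℝ))) :=
    integrable_one_add_norm (by rw [hN]; push_cast; linarith)
  set C := (2 : ℝ) ^ k * 2 ^ (k + N) with hC
  have hpt : ∀ (h : 𝓢(V, ℂ)) (x : V), ‖h x‖ * (1 + ‖WithLp.toLp 2 (x, x)‖) ^ k ≤
      C * ((Finset.Iic (k + N, 0)).sup (schwartzSeminormFamily ℂ V ℂ)) h *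
        (1 + ‖x‖) ^ (-(N : ℝ)) := by
    intro h x
    have h1 : 1 + ‖WithLp.toLp 2 (x, x)‖ ≤ 2 * (1 + ‖x‖) := by
      have : ‖WithLp.toLp 2 (x, x)‖ ≤ 2 * ‖x‖ := by
        rw [WithLp.prod_norm_eq_of_L2]
        refine Real.sqrt_le_iff.2 ⟨by positivity, ?_⟩
        simp only [WithLp.toLp_fst, WithLp.toLp_snd]
        nlinarith [norm_nonneg x]
      linarith
    have h2 : (1 + ‖x‖) ^ (k + N) * ‖iteratedFDeriv ℝ 0 h x‖ ≤ 2 ^ (k + N) *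
        ((Finset.Iic (k + N, 0)).sup (schwartzSeminormFamily ℂ V ℂ)) h :=
      one_add_le_sup_seminorm_apply (𝕜 := ℂ) (m := (k + N, 0)) le_rfl le_rfl h x
    rw [norm_iteratedFDeriv_zero] at h2
    have hpos : 0 < 1 + ‖x‖ := by positivity
    rw [Real.rpow_neg hpos.le, Real.rpow_natCast, ← div_eq_mul_inv, le_div_iff₀ (by positivity)]
    calc _ ≤ ‖h x‖ * (2 * (1 + ‖x‖)) ^ k * (1 + ‖x‖) ^ N := by gcongr
      _ = 2 ^ k * ((1 + ‖x‖) ^ (k + N) * ‖h x‖) := by rw [mul_pow, pow_add]; ring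
      _ ≤ _ := by rw [hC, mul_assoc]; gcongr
  refine ⟨Finset.Iic (k + N, 0), C * ∫ x : V, (1 + ‖x‖) ^ (-(N : ℝ)), ?_, fun h => ?_⟩
  · exact mul_nonneg (by positivity) (integral_nonneg fun x => by positivity)
  · have hint : Integrable (fun x => ‖h x‖ * (1 + ‖WithLp.toLp 2 (x, x)‖) ^ k) := by
      refine (hI.const_mul
        (C * ((Finset.Iic (k + N, 0)).sup (schwartzSeminormFamily ℂ V ℂ)) h)).mono' ?_
        (Filter.Eventually.of_forall fun x => ?_)
      · refine Continuous.aestronglyMeasurable ?_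
        refine h.continuous.norm.mul ((continuous_const.add (Continuous.norm ?_)).pow k)
        exact (WithLp.prod_continuous_toLp 2 V V).comp (by fun_prop)
      · rw [Real.norm_of_nonneg (by positivity)]
        exact hpt h x
    refine ⟨hint, ?_⟩
    refine (integral_mono hint (hI.const_mul _) (hpt h)).trans (le_of_eq ?_)
    rw [integral_const_mul]; ring

/-- The map `w ↦ -w` as a linear isometry. -/
abbrev negIsometry : WithLp 2 (V × V) →ₗᵢ[ℝ] WithLp 2 (V × V) :=
  (LinearIsometryEquiv.neg ℝ).toLinearIsometry

theorem admissible_diagonal (h : 𝓢(V, ℂ)) :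
    Admissible (volume : Measure V) (fun _ => negIsometry (V := V))
      (fun x => WithLp.toLp 2 (x, x)) h where
  contL := continuous_const
  contc := (WithLp.prod_continuous_toLp 2 V V).comp (by fun_prop)
  conth := h.continuous
  integrable k := by
    obtain ⟨s, C, -, hh⟩ := weight_bound (V := V) k
    exact (hh h).1

/-- For Schwartz functions `f`, `g`, the operator sending `h` to the Schwartz function
`(y, z) ↦ ∫ f(x - y) g(x - z) h(x) dx`. -/
def kernelTest (f g : 𝓢(V, ℂ)) : 𝓢(V, ℂ) →L[ℂ] 𝓢(WithLp 2 (V × V), ℂ) :=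
  SchwartzMap.mkCLM
    (fun h w => affineAverage (volume : Measure V) (fun _ => negIsometry (V := V))
      (fun x => WithLp.toLp 2 (x, x)) h (tensor f g) w)
    (fun h h' w => by
      simp only [affineAverage, add_apply, add_mul]
      exact integral_add (integrable_affine (admissible_diagonal h) (tensor f g) w)
        (integrable_affine (admissible_diagonal h') (tensor f g) w))
    (fun t h w => by
      simp only [affineAverage, smul_apply, smul_eq_mul, RingHom.id_apply]
      rw [← integral_const_mul]
      refine integral_congr_ae (Filter.Eventually.of_forall fun a => by ring_nf))
    (fun h => contDiff_affineAverage (admissible_diagonal h) (tensor f g))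
    (fun n => by
      obtain ⟨s, C, hC, hh⟩ := weight_bound (V := V) n.1
      refine ⟨s, C * (2 ^ n.1 * ((Finset.Iic (n.1, n.2)).sup
        (schwartzSeminormFamily ℂ (WithLp 2 (V × V)) ℂ)) (tensor f g)), by positivity,
        fun h w => ?_⟩
      refine (affineAverage_bound (admissible_diagonal h) (tensor f g) n.1 n.2 w).trans ?_
      rw [mul_right_comm]
      gcongr
      exact (hh h).2)

theorem kernelTest_apply (f g h : 𝓢(V, ℂ)) (w : WithLp 2 (V × V)) :
    kernelTest f g h w = ∫ x, f (x - w.fst) * g (x - w.snd) * h x := by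
  change ∫ x, h x * tensor f g (WithLp.toLp 2 (x, x) + -w) = _
  refine integral_congr_ae (Filter.Eventually.of_forall fun x => ?_)
  simp [sub_eq_add_neg, mul_comm]

/-- The bilinear operator `T_K` with kernel `K`, given by
`⟨T_K(f, g), h⟩ = ∫∫∫ K(y, z) f(x - y) g(x - z) h(x) dx dy dz`. -/
def bilinearOp (K : 𝓢'(WithLp 2 (V × V), ℂ)) (f g : 𝓢(V, ℂ)) : 𝓢'(V, ℂ) :=
  PointwiseConvergenceCLM.precomp ℂ (kernelTest f g) K

theorem bilinearOp_apply (K : 𝓢'(WithLp 2 (V × V), ℂ)) (f g h : 𝓢(V, ℂ)) :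
    bilinearOp K f g h = K (kernelTest f g h) := rfl

/-- The Marcinkiewicz condition for a function `m(ξ, η)`: `m` is smooth off `ξ = 0` and `η = 0`, and
`|ξ|^a |η|^b |D_ξ^a D_η^b m(ξ, η)|` is bounded there for all orders `a`, `b` (the norm of the mixed
Fréchet derivative of order `(a, b)` is comparable with the largest of the partial derivatives
`∂_ξ^α ∂_η^β m` with `|α| = a`, `|β| = b`). -/
def MarcinkiewiczCondition (m : V → V → ℂ) : Prop :=
  ContDiffOn ℝ ∞ (Function.uncurry m) {p | p.1 ≠ 0 ∧ p.2 ≠ 0} ∧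
  ∀ a b : ℕ, ∃ C : ℝ, ∀ ξ η : V, ξ ≠ 0 → η ≠ 0 →
    ‖ξ‖ ^ a * ‖η‖ ^ b *
      ‖iteratedFDeriv ℝ a (fun ξ' => iteratedFDeriv ℝ b (fun η' => m ξ' η') η) ξ‖ ≤ C

/-- `T_K` is a bilinear Fourier multiplier of Marcinkiewicz type: its symbol, the Fourier transform
of `K`, is (integration against) a function `m` satisfying the Marcinkiewicz condition, and
`⟨T_K(f, g), h⟩ = ∫∫ m(ξ, η) f̂(ξ) ĝ(η) ȟ(ξ + η) dξ dη`, where `ȟ(ζ) = ∫ h(x) e^{2πi x·ζ} dx`. -/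
def IsMarcinkiewiczMultiplier (K : 𝓢'(WithLp 2 (V × V), ℂ)) : Prop :=
  ∃ m : V → V → ℂ, MarcinkiewiczCondition m ∧
    (∀ φ : 𝓢(WithLp 2 (V × V), ℂ), 𝓕 K φ = ∫ p : WithLp 2 (V × V), m p.fst p.snd * φ p) ∧
    ∀ f g h : 𝓢(V, ℂ), bilinearOp K f g h =
      ∫ p : WithLp 2 (V × V), m p.fst p.snd * (𝓕 f p.fst * 𝓕 g p.snd * 𝓕⁻ h (p.fst + p.snd))

/-- `K(y, z)` is even in `y` and even in `z`. -/
def IsBiEven (K : 𝓢'(WithLp 2 (V × V), ℂ)) : Prop :=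
  ∀ φ ψ : 𝓢(WithLp 2 (V × V), ℂ),
    ((∀ y z, ψ (WithLp.toLp 2 (y, z)) = φ (WithLp.toLp 2 (-y, z))) → K ψ = K φ) ∧
    ((∀ y z, ψ (WithLp.toLp 2 (y, z)) = φ (WithLp.toLp 2 (y, -z))) → K ψ = K φ)

variable (V) in
/-- The kernel `K̃(y, z) = (|y| |z|)^{-(n-1)} K(|y|, |z|)` on `V × V`, `n = dim V`, of a bi-even
distribution `K` on `ℝ × ℝ`, defined through polar coordinates `y = r θ`, `z = s θ'`:
`⟨K̃, φ⟩ = ∫₀^∞ ∫₀^∞ K(r, s) Φ(r, s) dr ds = (1/4) ∫∫ K(r, s) Φ(r, s) dr ds` with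
`Φ(r, s) = ∫∫ φ(r θ, s θ') dσ(θ) dσ(θ')`, as the Jacobian `r^{n-1} s^{n-1}` cancels the factor
`(|y| |z|)^{-(n-1)}` and `K`, `Φ` are bi-even. -/
def radialKernel (K : 𝓢'(WithLp 2 (ℝ × ℝ), ℂ)) : 𝓢'(WithLp 2 (V × V), ℂ) :=
  (1 / 4 : ℂ) • PointwiseConvergenceCLM.precomp ℂ (sphereIntegral V) K

variable (V) in
theorem radialKernel_apply (K : 𝓢'(WithLp 2 (ℝ × ℝ), ℂ)) (φ : 𝓢(WithLp 2 (V × V), ℂ)) :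
    radialKernel V K φ = (1 / 4 : ℂ) * K (sphereIntegral V φ) := rfl

end kernelTest

end

end BilinearMultiplier

/-! The map `φ ↦ Φ` restricts `φ` to the planes `{(rθ, sθ')}` and averages over `θ, θ'`. On the
Fourier side, restriction to a plane is dual to orthogonal projection onto it. If `m` is the symbol
of `K`, the symbol of `K̃` is therefore `M(ξ, η) = ¼ ∫∫ m(⟨ξ, θ⟩, ⟨η, θ'⟩) dσ dσ`. Rotating each
sphere separately replaces `⟨ξ, θ⟩` by `|ξ| ⟨e, θ⟩` and `⟨η, θ'⟩` by `|η| ⟨e, θ'⟩` for a fixed unit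
vector `e`. Thus `M` is an average of dilates `m(s|ξ|, t|η|)`.

The Marcinkiewicz condition is dilation invariant with the same constants: differentiating `m(s·,
t·)` produces `|s|^a |t|^b`, exactly what the weights at the dilated point absorb. Small `s` or `t`
does no harm, so the average obeys the same type of bounds. Scaling `(ξ, η)` to unit vectors reduces
everything to bounds on a fixed product of annuli, where the norm is smooth; this is
`MarcinkiewiczCondition.radial_average`.

Since `m` is merely bounded and measurable, the projection formula is first proved for Schwartz
functions in place of `m` (`integral_mul_fourierInv_sphereIntegral`). It says that two finite
complex measures agree on Schwartz functions, so `integral_mul_eq_of_schwartz` extends it to `m`,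
giving `fourier_radialKernel_apply`. As `m` is unconstrained on the axes, it is replaced there by
`0` (`offAxes`). Finally the multiplier formula for `T_K̃` is the symbol identity tested on `𝓕⁻` of
the kernel test function, computed in `fourierInv_kernelTest_apply`. -/

namespace BilinearMultiplier

open MeasureTheory FourierTransform Set Filter Topology
open scoped ContDiff RealInnerProductSpace ENNReal Pointwise

set_option linter.unusedSectionVars false

noncomputable section

/-! ### Differentiation under the integral sign on an open set. -/

section parametric

variable {A E : Type*} [MeasurableSpace A] {μ : Measure A}
  [NormedAddCommGroup E] [NormedSpace ℝ E]

/-- Directional derivatives are limits of sequences of difference quotients, and finitely many of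
them, along a basis, determine the derivative. -/
theorem aestronglyMeasurable_fderiv_of_isOpen [FiniteDimensional ℝ E] {Y : Type*}
    [NormedAddCommGroup Y] [NormedSpace ℝ Y] {F : A → E → Y} {U : Set E} (hU : IsOpen U)
    (hF : ∀ x ∈ U, AEStronglyMeasurable (fun a => F a x) μ) {x : E} (hx : x ∈ U)
    (hd : ∀ a, DifferentiableAt ℝ (F a) x) :
    AEStronglyMeasurable (fun a => fderiv ℝ (F a) x) μ := by
  have hv : ∀ v : E, AEStronglyMeasurable (fun a => fderiv ℝ (F a) x v) μ := by
    intro v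
    have hc : Tendsto (fun n : ℕ => ‖((n : ℝ))‖) atTop atTop := by
      simpa using tendsto_natCast_atTop_atTop (R := ℝ)
    have hlim : Tendsto (fun n : ℕ => x + ((n : ℝ))⁻¹ • v) atTop (𝓝 x) := by
      have h := (tendsto_inv_atTop_nhds_zero_nat (𝕜 := ℝ)).smul_const v
      simpa using h.const_add x
    -- Measurability is known only at points of `U`, so the sequence is started at an index past
    -- which it stays in `U`.
    obtain ⟨N, hN⟩ := eventually_atTop.1 (hlim.eventually (hU.mem_nhds hx))
    refine aestronglyMeasurable_of_tendsto_ae atTop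
      (f := fun (n : ℕ) a => ((n + N : ℕ) : ℝ) • (F a (x + ((n + N : ℕ) : ℝ)⁻¹ • v) - F a x))
      (fun n => ((hF _ (hN _ (by omega))).sub (hF x hx)).const_smul _)
      (Eventually.of_forall fun a => ?_)
    exact ((hd a).hasFDerivAt.lim v hc).comp (tendsto_add_atTop_nat N)
  let b := Module.finBasis ℝ E
  have : (fun a => fderiv ℝ (F a) x) = fun a => ∑ i,
      ContinuousLinearMap.smulRightL ℝ E Y (b.coord i).toContinuousLinearMap
        (fderiv ℝ (F a) x (b i)) := by
    ext a v
    have hsum : fderiv ℝ (F a) x v = fderiv ℝ (F a) x (∑ i, b.repr v i • b i) := by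
      rw [b.sum_repr]
    rw [hsum, map_sum]
    simp
  rw [this]
  exact Finset.aestronglyMeasurable_fun_sum _ fun i _ =>
    (ContinuousLinearMap.continuous _).comp_aestronglyMeasurable (hv (b i))

theorem differentiableAt_iteratedFDeriv_of_contDiffOn {Y : Type*}
    [NormedAddCommGroup Y] [NormedSpace ℝ Y] {f : E → Y} {U : Set E} (hU : IsOpen U)
    (hf : ContDiffOn ℝ ∞ f U) (l : ℕ) {x : E} (hx : x ∈ U) :
    DifferentiableAt ℝ (iteratedFDeriv ℝ l f) x :=
  ((hf.contDiffAt (hU.mem_nhds hx)).iteratedFDeriv_right (m := 1) (i := l)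
    (by exact_mod_cast le_top)).differentiableAt one_ne_zero

variable [FiniteDimensional ℝ E]

theorem aestronglyMeasurable_iteratedFDeriv_of_isOpen {G : A → E → ℂ} {U : Set E} (hU : IsOpen U)
    (hG : ∀ a, ContDiffOn ℝ ∞ (G a) U) (hm : ∀ x ∈ U, AEStronglyMeasurable (fun a => G a x) μ)
    (l : ℕ) : ∀ x ∈ U, AEStronglyMeasurable (fun a => iteratedFDeriv ℝ l (G a) x) μ := by
  induction l with
  | zero =>
    intro x hx
    simp_rw [iteratedFDeriv_zero_eq_comp]
    exact (LinearIsometryEquiv.continuous _).comp_aestronglyMeasurable (hm x hx)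
  | succ l ih =>
    intro x hx
    simp_rw [iteratedFDeriv_succ_eq_comp_left]
    exact (LinearIsometryEquiv.continuous _).comp_aestronglyMeasurable
      (aestronglyMeasurable_fderiv_of_isOpen hU ih hx
        fun a => differentiableAt_iteratedFDeriv_of_contDiffOn hU (hG a) l hx)

/-- Bounds uniform in the parameter are integrable because `μ` is finite, so dominated convergence
applies at every order. Working on `U` allows integrands that are singular on the axes. -/
theorem hasFTaylorSeriesUpToOn_integral [IsFiniteMeasure μ] {G : A → E → ℂ} {U : Set E}
    (hU : IsOpen U) (hG : ∀ a, ContDiffOn ℝ ∞ (G a) U)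
    (hm : ∀ x ∈ U, AEStronglyMeasurable (fun a => G a x) μ) {C : ℕ → ℝ}
    (hC : ∀ l a, ∀ x ∈ U, ‖iteratedFDeriv ℝ l (G a) x‖ ≤ C l) :
    HasFTaylorSeriesUpToOn ∞ (fun x => ∫ a, G a x ∂μ)
      (fun x l => ∫ a, iteratedFDeriv ℝ l (G a) x ∂μ) U := by
  have hm' := aestronglyMeasurable_iteratedFDeriv_of_isOpen hU hG hm
  have hint : ∀ l, ∀ x ∈ U, Integrable (fun a => iteratedFDeriv ℝ l (G a) x) μ := fun l x hx =>
    (integrable_const (C l)).mono' (hm' l x hx) (Eventually.of_forall fun a => hC l a x hx)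
  have hder : ∀ (l : ℕ), ∀ x ∈ U, HasFDerivAt (fun y => ∫ a, iteratedFDeriv ℝ l (G a) y ∂μ)
      (∫ a, iteratedFDeriv ℝ (l + 1) (G a) x ∂μ).curryLeft x := by
    intro l x hx
    let Q := (continuousMultilinearCurryLeftEquiv ℝ (fun _ : Fin (l + 1) => E) ℂ)
    have hQ : ∀ a y, Q (iteratedFDeriv ℝ (l + 1) (G a) y) = fderiv ℝ (iteratedFDeriv ℝ l (G a)) y := by
      intro a y
      rw [iteratedFDeriv_succ_eq_comp_left]
      exact LinearIsometryEquiv.apply_symm_apply _ _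
    have h1 := hasFDerivAt_integral_of_dominated_of_fderiv_le (𝕜 := ℝ) (s := U) (μ := μ) (x₀ := x)
      (F := fun y a => iteratedFDeriv ℝ l (G a) y)
      (F' := fun y a => Q (iteratedFDeriv ℝ (l + 1) (G a) y))
      (bound := fun _ => C (l + 1)) (hU.mem_nhds hx)
      (by filter_upwards [hU.mem_nhds hx] with y hy using hm' l y hy) (hint l x hx)
      (Q.continuous.comp_aestronglyMeasurable (hm' (l + 1) x hx))
      (Eventually.of_forall fun a y hy => by rw [Q.norm_map]; exact hC _ a y hy)
      (integrable_const _)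
      (Eventually.of_forall fun a y hy => by
        rw [hQ]
        exact (differentiableAt_iteratedFDeriv_of_contDiffOn hU (hG a) l hy).hasFDerivAt)
    let Q' : (ContinuousMultilinearMap ℝ (fun _ : Fin (l + 1) => E) ℂ) →L[ℝ]
      (E →L[ℝ] ContinuousMultilinearMap ℝ (fun _ : Fin l => E) ℂ) := Q.toContinuousLinearEquiv
    have h2 := ContinuousLinearMap.integral_comp_comm (𝕜 := ℝ)
      (Fₗ := E →L[ℝ] ContinuousMultilinearMap ℝ (fun _ : Fin l => E) ℂ) Q' (hint (l + 1) x hx)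
    change ∫ a, Q _ ∂μ = Q _ at h2
    rw [h2] at h1
    exact h1
  refine ⟨fun x hx => ?_, fun l _ x hx => (hder l x hx).hasFDerivWithinAt, fun l _ => ?_⟩
  · have h0 := (continuousMultilinearCurryFin0 ℝ E ℂ).toContinuousLinearEquiv.toContinuousLinearMap.integral_comp_comm
      (hint 0 x hx)
    change (continuousMultilinearCurryFin0 ℝ E ℂ) _ = _
    refine h0.symm.trans ?_
    simp
  · exact fun x hx => (hder l x hx).continuousAt.continuousWithinAt

theorem norm_iteratedFDeriv_integral_le [IsFiniteMeasure μ] {G : A → E → ℂ} {U : Set E}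
    (hU : IsOpen U) (hG : ∀ a, ContDiffOn ℝ ∞ (G a) U)
    (hm : ∀ x ∈ U, AEStronglyMeasurable (fun a => G a x) μ) {C : ℕ → ℝ}
    (hC : ∀ l a, ∀ x ∈ U, ‖iteratedFDeriv ℝ l (G a) x‖ ≤ C l) (l : ℕ) {x : E} (hx : x ∈ U) :
    ‖iteratedFDeriv ℝ l (fun x => ∫ a, G a x ∂μ) x‖ ≤ C l * μ.real univ := by
  rw [← iteratedFDerivWithin_of_isOpen l hU hx,
    ← (hasFTaylorSeriesUpToOn_integral hU hG hm hC).eq_iteratedFDerivWithin_of_uniqueDiffOn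
      (m := l) (by exact_mod_cast le_top) hU.uniqueDiffOn hx]
  exact norm_integral_le_of_norm_le_const (Eventually.of_forall fun a => hC l a x hx)

end parametric

/-! ### Mixed Fréchet derivatives: comparison with full derivatives, and dilations. -/

section mixed

variable {E F X : Type*} [NormedAddCommGroup E] [NormedSpace ℝ E] [NormedAddCommGroup F]
  [NormedSpace ℝ F] [NormedAddCommGroup X] [NormedSpace ℝ X]

theorem norm_iteratedFDeriv_iteratedFDeriv (f : E → X) (a b : ℕ) (x : E) :
    ‖iteratedFDeriv ℝ a (iteratedFDeriv ℝ b f) x‖ = ‖iteratedFDeriv ℝ (a + b) f x‖ := by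
  induction b generalizing a with
  | zero =>
    rw [iteratedFDeriv_zero_eq_comp]
    exact LinearIsometryEquiv.norm_iteratedFDeriv_comp_left _ _ _ _
  | succ b ih =>
    rw [iteratedFDeriv_succ_eq_comp_left]
    let Q : (E →L[ℝ] ContinuousMultilinearMap ℝ (fun _ : Fin b => E) X) ≃ₗᵢ[ℝ]
      (ContinuousMultilinearMap ℝ (fun _ : Fin (b + 1) => E) X) :=
      (continuousMultilinearCurryLeftEquiv ℝ (fun _ : Fin (b + 1) => E) X).symm
    have h := LinearIsometryEquiv.norm_iteratedFDeriv_comp_left (𝕜 := ℝ)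
      (G := ContinuousMultilinearMap ℝ (fun _ : Fin (b + 1) => E) X) Q (fderiv ℝ (iteratedFDeriv ℝ b f)) x a
    refine h.trans ?_
    rw [norm_iteratedFDeriv_fderiv, ih, show a + 1 + b = a + (b + 1) by omega]

theorem iteratedFDeriv_comp_affine {f : F → X} {U : Set F} (hU : IsOpen U)
    (hf : ContDiffOn ℝ ∞ f U) (c : F) (L : E →L[ℝ] F) (i : ℕ) {x : E} (hx : c + L x ∈ U) :
    iteratedFDeriv ℝ i (fun y => f (c + L y)) x =
      (iteratedFDeriv ℝ i f (c + L x)).compContinuousLinearMap fun _ => L := by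
  have hV : IsOpen ((fun z => c + z) ⁻¹' U) := hU.preimage (by fun_prop)
  have hg : ContDiffOn ℝ ∞ (fun z => f (c + z)) ((fun z => c + z) ⁻¹' U) :=
    hf.comp (by fun_prop) fun _ h => h
  have h := L.iteratedFDerivWithin_comp_right hg hV.uniqueDiffOn
    (hV.preimage L.continuous).uniqueDiffOn (x := x) hx (i := i) (by exact_mod_cast le_top)
  rw [iteratedFDerivWithin_of_isOpen i (hV.preimage L.continuous) hx,
    iteratedFDerivWithin_of_isOpen i hV hx, iteratedFDeriv_comp_add_left] at h
  exact h

/-- The mixed derivative is the full derivative of order `a + b` with `b` slots fed through `inr`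
and `a` slots through `inl`; both inclusions have norm at most one. -/
theorem norm_iteratedFDeriv_iteratedFDeriv_slice_le {f : E × F → X} {U : Set (E × F)}
    (hU : IsOpen U) (hf : ContDiffOn ℝ ∞ f U) (a b : ℕ) {x : E} {y : F} (hx : (x, y) ∈ U) :
    ‖iteratedFDeriv ℝ a (fun x' => iteratedFDeriv ℝ b (fun y' => f (x', y')) y) x‖ ≤
      ‖iteratedFDeriv ℝ (a + b) f (x, y)‖ := by
  have hslice : ∀ᶠ x' in 𝓝 x, (x', y) ∈ U :=
    (Continuous.prodMk_left y).continuousAt.preimage_mem_nhds (hU.mem_nhds hx)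
  let L := ContinuousMultilinearMap.compContinuousLinearMapL (𝕜 := ℝ) (F := X)
    (fun _ : Fin b => ContinuousLinearMap.inr ℝ E F)
  have hL : ‖L‖ ≤ 1 := by
    refine (ContinuousMultilinearMap.norm_compContinuousLinearMapL_le _ _).trans ?_
    exact Finset.prod_le_one (fun _ _ => norm_nonneg _)
      fun _ _ => ContinuousLinearMap.norm_inr_le_one ℝ E F
  have hD : ContDiffOn ℝ ∞ (iteratedFDeriv ℝ b f) U := fun p hp =>
    ((hf.contDiffAt (hU.mem_nhds hp)).iteratedFDeriv_right (m := ∞) (i := b)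
      (by exact_mod_cast le_top)).contDiffWithinAt
  have heq : (fun x' => iteratedFDeriv ℝ b (fun y' => f (x', y')) y) =ᶠ[𝓝 x]
      L ∘ fun x' => iteratedFDeriv ℝ b f ((0, y) + ContinuousLinearMap.inl ℝ E F x') := by
    filter_upwards [hslice] with x' hx'
    have := iteratedFDeriv_comp_affine hU hf (x', 0) (ContinuousLinearMap.inr ℝ E F) b (x := y)
      (by simpa using hx')
    simpa [L] using this
  have hsm : ContDiffAt ℝ ∞
      (fun x' => iteratedFDeriv ℝ b f ((0, y) + ContinuousLinearMap.inl ℝ E F x')) x :=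
    (hD.contDiffAt (hU.mem_nhds (by simpa using hx))).comp x (by fun_prop)
  rw [(heq.iteratedFDeriv ℝ a).eq_of_nhds,
    L.iteratedFDeriv_comp_left hsm (by exact_mod_cast le_top),
    iteratedFDeriv_comp_affine hU hD _ _ _ (by simpa using hx)]
  refine (ContinuousLinearMap.norm_compContinuousMultilinearMap_le _ _).trans ?_
  refine (mul_le_of_le_one_left (norm_nonneg _) hL).trans ?_
  refine (ContinuousMultilinearMap.norm_compContinuousLinearMap_le _ _).trans ?_
  refine (mul_le_of_le_one_right (norm_nonneg _) (Finset.prod_le_one (fun _ _ => norm_nonneg _)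
    fun _ _ => ContinuousLinearMap.norm_inl_le_one ℝ E F)).trans ?_
  rw [norm_iteratedFDeriv_iteratedFDeriv]
  simp

theorem iteratedFDeriv_comp_smul {s : ℝ} (hs : s ≠ 0) (f : E → X) (i : ℕ) (x : E) :
    iteratedFDeriv ℝ i (fun y => f (s • y)) x = s ^ i • iteratedFDeriv ℝ i f (s • x) := by
  let e : E ≃L[ℝ] E := ContinuousLinearEquiv.smulLeft (Units.mk0 s hs)
  have h := e.iteratedFDerivWithin_comp_right f uniqueDiffOn_univ (mem_univ (e x)) i
  rw [preimage_univ, iteratedFDerivWithin_univ, iteratedFDerivWithin_univ] at h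
  refine Eq.trans h ?_
  ext v
  simp only [ContinuousMultilinearMap.compContinuousLinearMap_apply]
  change iteratedFDeriv ℝ i f (s • x) (fun j => s • v j) = _
  rw [ContinuousMultilinearMap.map_smul_univ]
  simp

theorem norm_iteratedFDeriv_smul {s : ℝ} (hs : s ≠ 0) (f : E → X) (i : ℕ) (x : E) :
    ‖iteratedFDeriv ℝ i (fun y => s • f y) x‖ = |s| * ‖iteratedFDeriv ℝ i f x‖ := by
  let e : X ≃L[ℝ] X := ContinuousLinearEquiv.smulLeft (Units.mk0 s hs)
  have h := e.iteratedFDeriv_comp_left (f := f) (x := x) (i := i)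
  have h2 : (e ∘ f) = fun y => s • f y := rfl
  have h3 : e.toContinuousLinearMap.compContinuousMultilinearMap (iteratedFDeriv ℝ i f x) =
    s • iteratedFDeriv ℝ i f x := rfl
  rw [← h2, h, h3, norm_smul, Real.norm_eq_abs]

/-- This scaling law is the source of the dilation invariance of the Marcinkiewicz condition. -/
theorem norm_iteratedFDeriv_iteratedFDeriv_dilate {s t : ℝ} (hs : s ≠ 0) (ht : t ≠ 0)
    (m : E → F → X) (a b : ℕ) (x : E) (y : F) :
    ‖iteratedFDeriv ℝ a (fun x' => iteratedFDeriv ℝ b (fun y' => m (s • x') (t • y')) y) x‖ =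
      |s| ^ a * |t| ^ b * ‖iteratedFDeriv ℝ a
        (fun x' => iteratedFDeriv ℝ b (fun y' => m x' y') (t • y)) (s • x)‖ := by
  have h1 : (fun x' => iteratedFDeriv ℝ b (fun y' => m (s • x') (t • y')) y) =
      fun x' => t ^ b • iteratedFDeriv ℝ b (fun y' => m (s • x') y') (t • y) := by
    ext1 x'
    exact iteratedFDeriv_comp_smul ht (m (s • x')) b y
  rw [h1, norm_iteratedFDeriv_smul (pow_ne_zero _ ht),
    iteratedFDeriv_comp_smul hs (fun x' => iteratedFDeriv ℝ b (fun y' => m x' y') (t • y)),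
    norm_smul, Real.norm_eq_abs, abs_pow, abs_pow]
  ring

end mixed

/-! ### Derivatives on the plane in terms of iterated partial derivatives. -/

section plane

variable {U : Set (ℝ × ℝ)} {f g : ℝ × ℝ → ℂ}

/-- The partial derivative along the vector `v`. -/
def partialDeriv (v : ℝ × ℝ) (f : ℝ × ℝ → ℂ) (p : ℝ × ℝ) : ℂ := fderiv ℝ f p v

theorem contDiffOn_partialDeriv (hU : IsOpen U) (hf : ContDiffOn ℝ ∞ f U) (v : ℝ × ℝ) :
    ContDiffOn ℝ ∞ (partialDeriv v f) U :=
  (hf.fderiv_of_isOpen hU (m := ∞) (by simp)).clm_apply contDiffOn_const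

theorem contDiffOn_iterate_partialDeriv (hU : IsOpen U) (v : ℝ × ℝ) (b : ℕ)
    (hf : ContDiffOn ℝ ∞ f U) : ContDiffOn ℝ ∞ ((partialDeriv v)^[b] f) U := by
  induction b generalizing f with
  | zero => exact hf
  | succ b ih => exact ih (contDiffOn_partialDeriv hU hf v)

theorem partialDeriv_congr (hU : IsOpen U) (h : EqOn f g U) (v : ℝ × ℝ) :
    EqOn (partialDeriv v f) (partialDeriv v g) U := fun p hp => by
  have : f =ᶠ[𝓝 p] g := by filter_upwards [hU.mem_nhds hp] with q hq using h hq
  simp only [partialDeriv, this.fderiv_eq]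

theorem iterate_partialDeriv_congr (hU : IsOpen U) (h : EqOn f g U) (v : ℝ × ℝ) (b : ℕ) :
    EqOn ((partialDeriv v)^[b] f) ((partialDeriv v)^[b] g) U := by
  induction b generalizing f g with
  | zero => exact h
  | succ b ih => exact ih (partialDeriv_congr hU h v)

theorem partialDeriv_comm (hU : IsOpen U) (hf : ContDiffOn ℝ ∞ f U) (v w : ℝ × ℝ) :
    EqOn (partialDeriv v (partialDeriv w f)) (partialDeriv w (partialDeriv v f)) U := by
  intro p hp
  have hs : IsSymmSndFDerivAt ℝ f p :=
    (hf.contDiffAt (hU.mem_nhds hp)).isSymmSndFDerivAt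
      (by simpa using WithTop.coe_le_coe.2 (le_top : (2 : ℕ∞) ≤ ⊤))
  have hd : DifferentiableAt ℝ (fderiv ℝ f) p :=
    ((hf.fderiv_of_isOpen hU (m := ∞) (by simp)).contDiffAt (hU.mem_nhds hp)).differentiableAt
      (by simp)
  have h : ∀ v w : ℝ × ℝ, partialDeriv v (partialDeriv w f) p = fderiv ℝ (fderiv ℝ f) p v w := by
    intro v w
    change fderiv ℝ (fun q => fderiv ℝ f q w) p v = _
    rw [fderiv_clm_apply hd (differentiableAt_const _)]
    simp
  rw [h, h, hs.eq]

theorem iterate_partialDeriv_comm (hU : IsOpen U) (v w : ℝ × ℝ) (b : ℕ)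
    (hf : ContDiffOn ℝ ∞ f U) :
    EqOn ((partialDeriv w)^[b] (partialDeriv v f)) (partialDeriv v ((partialDeriv w)^[b] f)) U := by
  induction b generalizing f with
  | zero => exact fun _ _ => rfl
  | succ b ih =>
    rw [Function.iterate_succ_apply, Function.iterate_succ_apply]
    exact (iterate_partialDeriv_congr hU (partialDeriv_comm hU hf w v) w b).trans
      (ih (contDiffOn_partialDeriv hU hf w))

/-- Writing `Df = dx ⊗ ∂₁f + dy ⊗ ∂₂f` with coordinate forms of norm at most one, each order doubles
the number of terms, whence `2 ^ N`. -/
theorem norm_iteratedFDeriv_le_of_partialDeriv (hU : IsOpen U) {p : ℝ × ℝ} (hp : p ∈ U) {B : ℝ}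
    (N : ℕ) (hf : ContDiffOn ℝ ∞ f U)
    (hB : ∀ a b, a + b = N → ‖(partialDeriv (1, 0))^[a] ((partialDeriv (0, 1))^[b] f) p‖ ≤ B) :
    ‖iteratedFDeriv ℝ N f p‖ ≤ 2 ^ N * B := by
  induction N generalizing f with
  | zero => simpa using hB 0 0 rfl
  | succ N ih =>
    have h1 : ∀ v, ContDiffOn ℝ ∞ (partialDeriv v f) U := contDiffOn_partialDeriv hU hf
    have e : fderiv ℝ f = (fun q => ContinuousLinearMap.smulRightL ℝ (ℝ × ℝ) ℂ
        (ContinuousLinearMap.fst ℝ ℝ ℝ) (partialDeriv (1, 0) f q)) +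
        fun q => ContinuousLinearMap.smulRightL ℝ (ℝ × ℝ) ℂ
        (ContinuousLinearMap.snd ℝ ℝ ℝ) (partialDeriv (0, 1) f q) := by
      ext q <;> simp [partialDeriv]
    have key : ∀ (ℓ : ℝ × ℝ →L[ℝ] ℝ) (v : ℝ × ℝ), ‖ℓ‖ ≤ 1 →
        ContDiffAt ℝ N (fun q => ContinuousLinearMap.smulRightL ℝ (ℝ × ℝ) ℂ ℓ (partialDeriv v f q)) p ∧
        ‖iteratedFDeriv ℝ N (fun q => ContinuousLinearMap.smulRightL ℝ (ℝ × ℝ) ℂ ℓ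
          (partialDeriv v f q)) p‖ ≤ ‖iteratedFDeriv ℝ N (partialDeriv v f) p‖ := by
      intro ℓ v hℓ
      have hc : ContDiffAt ℝ N (partialDeriv v f) p :=
        ((h1 v).contDiffAt (hU.mem_nhds hp)).of_le (by exact_mod_cast le_top)
      refine ⟨(ContinuousLinearMap.contDiff _).contDiffAt.comp p hc, ?_⟩
      have := (ContinuousLinearMap.smulRightL ℝ (ℝ × ℝ) ℂ ℓ).iteratedFDeriv_comp_left hc le_rfl
      change ‖iteratedFDeriv ℝ N (ContinuousLinearMap.smulRightL ℝ (ℝ × ℝ) ℂ ℓ ∘ _) p‖ ≤ _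
      rw [this]
      refine (ContinuousLinearMap.norm_compContinuousMultilinearMap_le _ _).trans ?_
      refine mul_le_of_le_one_left (norm_nonneg _) ?_
      refine ContinuousLinearMap.opNorm_le_bound _ zero_le_one fun z => ?_
      change ‖ContinuousLinearMap.smulRight ℓ z‖ ≤ _
      rw [ContinuousLinearMap.norm_smulRight_apply]
      gcongr
    obtain ⟨c1, n1⟩ := key (ContinuousLinearMap.fst ℝ ℝ ℝ) (1, 0)
      (ContinuousLinearMap.norm_fst_le ℝ ℝ ℝ)
    obtain ⟨c2, n2⟩ := key (ContinuousLinearMap.snd ℝ ℝ ℝ) (0, 1)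
      (ContinuousLinearMap.norm_snd_le ℝ ℝ ℝ)
    rw [← norm_iteratedFDeriv_fderiv, e, iteratedFDeriv_add_apply c1 c2]
    -- Here the new `∂₁` sits inside the `∂₂`'s and must be commuted outwards; for the `∂₂` term
    -- below, the order is already right.
    have b1 := ih (h1 (1, 0)) fun a b hab => by
      have hc : EqOn ((partialDeriv (1, 0))^[a] ((partialDeriv (0, 1))^[b] (partialDeriv (1, 0) f)))
          ((partialDeriv (1, 0))^[a] (partialDeriv (1, 0) ((partialDeriv (0, 1))^[b] f))) U :=
        iterate_partialDeriv_congr hU (iterate_partialDeriv_comm hU _ _ b hf) _ a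
      rw [hc hp]
      exact hB (a + 1) b (by omega)
    have b2 := ih (h1 (0, 1)) fun a b hab => hB a (b + 1) (by omega)
    refine (norm_add_le _ _).trans ((add_le_add (n1.trans b1) (n2.trans b2)).trans (le_of_eq ?_))
    ring

theorem iteratedDeriv_slice_right (hU : IsOpen U) (b : ℕ) (hf : ContDiffOn ℝ ∞ f U) {x y : ℝ}
    (hp : (x, y) ∈ U) :
    iteratedDeriv b (fun y' => f (x, y')) y = (partialDeriv (0, 1))^[b] f (x, y) := by
  induction b generalizing f with
  | zero => simp
  | succ b ih =>
    rw [iteratedDeriv_succ', Function.iterate_succ_apply,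
      ← ih (contDiffOn_partialDeriv hU hf (0, 1))]
    refine Filter.EventuallyEq.iteratedDeriv_eq b ?_
    have : ∀ᶠ y' in 𝓝 y, (x, y') ∈ U :=
      (Continuous.prodMk_right x).continuousAt.preimage_mem_nhds (hU.mem_nhds hp)
    filter_upwards [this] with y' hy'
    have hd : DifferentiableAt ℝ f (x, y') :=
      (hf.contDiffAt (hU.mem_nhds hy')).differentiableAt (by simp)
    exact (hd.hasFDerivAt.comp_hasDerivAt y'
      ((hasDerivAt_const y' x).prodMk (hasDerivAt_id y'))).deriv

theorem iteratedDeriv_slice_left (hU : IsOpen U) (b : ℕ) (hf : ContDiffOn ℝ ∞ f U) {x y : ℝ}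
    (hp : (x, y) ∈ U) :
    iteratedDeriv b (fun x' => f (x', y)) x = (partialDeriv (1, 0))^[b] f (x, y) := by
  induction b generalizing f with
  | zero => simp
  | succ b ih =>
    rw [iteratedDeriv_succ', Function.iterate_succ_apply,
      ← ih (contDiffOn_partialDeriv hU hf (1, 0))]
    refine Filter.EventuallyEq.iteratedDeriv_eq b ?_
    have : ∀ᶠ x' in 𝓝 x, (x', y) ∈ U :=
      (Continuous.prodMk_left y).continuousAt.preimage_mem_nhds (hU.mem_nhds hp)
    filter_upwards [this] with x' hx'
    have hd : DifferentiableAt ℝ f (x', y) :=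
      (hf.contDiffAt (hU.mem_nhds hx')).differentiableAt (by simp)
    exact (hd.hasFDerivAt.comp_hasDerivAt x'
      ((hasDerivAt_id x').prodMk (hasDerivAt_const x' y))).deriv

/-- In one variable a multilinear derivative is isometric to its value on `(1, …, 1)`. This
translates the hypothesis on `m` into bounds on partial derivatives. -/
theorem norm_iteratedFDeriv_slice_eq (hU : IsOpen U) (hf : ContDiffOn ℝ ∞ f U) (a b : ℕ) {x y : ℝ}
    (hp : (x, y) ∈ U) :
    ‖iteratedFDeriv ℝ a (fun x' => iteratedFDeriv ℝ b (fun y' => f (x', y')) y) x‖ =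
      ‖(partialDeriv (1, 0))^[a] ((partialDeriv (0, 1))^[b] f) (x, y)‖ := by
  simp_rw [iteratedFDeriv_eq_equiv_comp (n := b), Function.comp_apply]
  have h := LinearIsometryEquiv.norm_iteratedFDeriv_comp_left
    (ContinuousMultilinearMap.piFieldEquiv ℝ (Fin b) ℂ)
    (fun x' => iteratedDeriv b (fun y' => f (x', y')) y) x a
  refine h.trans ?_
  rw [norm_iteratedFDeriv_eq_norm_iteratedDeriv,
    ← iteratedDeriv_slice_left hU a (contDiffOn_iterate_partialDeriv hU _ b hf) hp]
  congr 1
  refine Filter.EventuallyEq.iteratedDeriv_eq a ?_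
  have : ∀ᶠ x' in 𝓝 x, (x', y) ∈ U :=
    (Continuous.prodMk_left y).continuousAt.preimage_mem_nhds (hU.mem_nhds hp)
  filter_upwards [this] with x' hx'
  exact iteratedDeriv_slice_right hU b hf hx'

end plane

/-! ### Radial averages of dilates preserve the Marcinkiewicz condition. -/

section radial

variable {V : Type*} [NormedAddCommGroup V] [InnerProductSpace ℝ V]

/-- The pairs of nonzero vectors. -/
abbrev offAxesSet (V : Type*) [NormedAddCommGroup V] : Set (V × V) := {p | p.1 ≠ 0 ∧ p.2 ≠ 0}

/-- The pairs of vectors with norms between `1/2` and `2`. -/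
def annulusPair (V : Type*) [NormedAddCommGroup V] : Set (V × V) :=
  {p | (1 / 2 < ‖p.1‖ ∧ ‖p.1‖ < 2) ∧ (1 / 2 < ‖p.2‖ ∧ ‖p.2‖ < 2)}

theorem isOpen_offAxesSet : IsOpen (offAxesSet V) :=
  (isOpen_ne_fun continuous_fst continuous_const).inter
    (isOpen_ne_fun continuous_snd continuous_const)

theorem isOpen_annulusPair : IsOpen (annulusPair V) :=
  ((isOpen_lt continuous_const continuous_fst.norm).inter
    (isOpen_lt continuous_fst.norm continuous_const)).inter
  ((isOpen_lt continuous_const continuous_snd.norm).inter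
    (isOpen_lt continuous_snd.norm continuous_const))

theorem annulusPair_subset : annulusPair V ⊆ offAxesSet V := fun p hp =>
  ⟨norm_pos_iff.1 (by linarith [hp.1.1]), norm_pos_iff.1 (by linarith [hp.2.1])⟩

theorem norm_mem_annulusPair {p : V × V} (hp : p ∈ annulusPair V) :
    (‖p.1‖, ‖p.2‖) ∈ annulusPair ℝ := by
  simpa [annulusPair] using hp

/-- The function equal to `m` off the axes and to `0` on them. -/
def offAxes (m : V → V → ℂ) (ξ η : V) : ℂ :=
  (offAxesSet V).indicator (Function.uncurry m) (ξ, η)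

theorem offAxes_of_ne {m : V → V → ℂ} {ξ η : V} (hξ : ξ ≠ 0) (hη : η ≠ 0) :
    offAxes m ξ η = m ξ η :=
  indicator_of_mem (s := offAxesSet V) (show (ξ, η) ∈ offAxesSet V from ⟨hξ, hη⟩) _

theorem offAxes_zero_left (m : V → V → ℂ) (η : V) : offAxes m 0 η = 0 :=
  indicator_of_notMem (fun h => h.1 rfl) _

theorem offAxes_zero_right (m : V → V → ℂ) (ξ : V) : offAxes m ξ 0 = 0 :=
  indicator_of_notMem (fun h => h.2 rfl) _

theorem MarcinkiewiczCondition.offAxes [FiniteDimensional ℝ V] [MeasurableSpace V] [BorelSpace V]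
    {m : V → V → ℂ} (hm : MarcinkiewiczCondition m) : MarcinkiewiczCondition (offAxes m) := by
  refine ⟨hm.1.congr fun p hp => offAxes_of_ne hp.1 hp.2, fun a b => ?_⟩
  obtain ⟨C, hC⟩ := hm.2 a b
  refine ⟨C, fun ξ η hξ hη => ?_⟩
  have h : (fun ξ' => iteratedFDeriv ℝ b (fun η' => BilinearMultiplier.offAxes m ξ' η') η) =ᶠ[𝓝 ξ]
      fun ξ' => iteratedFDeriv ℝ b (fun η' => m ξ' η') η := by
    filter_upwards [isOpen_ne.mem_nhds hξ] with ξ' hξ'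
    refine Filter.EventuallyEq.eq_of_nhds (Filter.EventuallyEq.iteratedFDeriv ℝ ?_ b)
    filter_upwards [isOpen_ne.mem_nhds hη] with η' hη' using offAxes_of_ne hξ' hη'
  rw [(h.iteratedFDeriv ℝ a).eq_of_nhds]
  exact hC ξ η hξ hη

/-- The values of `m` on the axes are arbitrary, so `m` itself need not be measurable; the cut-off
function is continuous off a closed set and constant on it. -/
theorem measurable_offAxes [FiniteDimensional ℝ V] [MeasurableSpace V] [BorelSpace V]
    {m : V → V → ℂ} (hm : MarcinkiewiczCondition m) :
    Measurable (Function.uncurry (offAxes m)) := by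
  have : SecondCountableTopology V := secondCountable_of_proper
  classical
  have : Measurable ((offAxesSet V).piecewise (Function.uncurry m) (fun _ => (0 : ℂ))) :=
    hm.1.continuousOn.measurable_piecewise continuousOn_const isOpen_offAxesSet.measurableSet
  have e : (offAxesSet V).piecewise (Function.uncurry m) (fun _ => (0 : ℂ)) =
      (offAxesSet V).indicator (Function.uncurry m) := Set.piecewise_eq_indicator
  rwa [e] at this

theorem exists_norm_offAxes_le [FiniteDimensional ℝ V] [MeasurableSpace V] [BorelSpace V]
    {m : V → V → ℂ} (hm : MarcinkiewiczCondition m) : ∃ C, ∀ ξ η, ‖offAxes m ξ η‖ ≤ C := by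
  obtain ⟨C, hC⟩ := hm.2 0 0
  refine ⟨max C 0, fun ξ η => ?_⟩
  by_cases h : ξ ≠ 0 ∧ η ≠ 0
  · rw [offAxes_of_ne h.1 h.2]
    simpa using (hC ξ η h.1 h.2).trans (le_max_left C 0)
  · rw [offAxes, indicator_of_notMem (by exact h)]
    simp

/-- The point is uniformity in `t` and `s`: the factors `|t|^a |s|^b` from the chain rule are
comparable on the annuli to the weights at `(t p₁, s p₂)`. -/
theorem exists_norm_iteratedFDeriv_dilate_le {m : ℝ → ℝ → ℂ} (hm : MarcinkiewiczCondition m)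
    (N : ℕ) : ∃ C, ∀ t s : ℝ, t ≠ 0 → s ≠ 0 → ∀ p ∈ annulusPair ℝ,
      ‖iteratedFDeriv ℝ N (fun q : ℝ × ℝ => m (t * q.1) (s * q.2)) p‖ ≤ C := by
  choose C hC using hm.2
  refine ⟨2 ^ N * ∑ i ∈ Finset.range (N + 1), 2 ^ N * |C i (N - i)|, fun t s ht hs p hp => ?_⟩
  have hf : ContDiffOn ℝ ∞ (fun q : ℝ × ℝ => m (t * q.1) (s * q.2)) (offAxesSet ℝ) :=
    hm.1.comp (f := fun q : ℝ × ℝ => (t * q.1, s * q.2)) (by fun_prop)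
      fun q hq => ⟨mul_ne_zero ht hq.1, mul_ne_zero hs hq.2⟩
  have hp' := annulusPair_subset hp
  refine norm_iteratedFDeriv_le_of_partialDeriv isOpen_offAxesSet hp' N hf fun a b hab => ?_
  rw [← norm_iteratedFDeriv_slice_eq isOpen_offAxesSet hf a b hp']
  have h1 := norm_iteratedFDeriv_iteratedFDeriv_dilate ht hs m a b p.1 p.2
  simp only [smul_eq_mul] at h1
  rw [h1]
  have h2 := hC a b (t * p.1) (s * p.2) (mul_ne_zero ht hp'.1) (mul_ne_zero hs hp'.2)
  set B := ‖iteratedFDeriv ℝ a (fun x' => iteratedFDeriv ℝ b (fun y' => m x' y') (s * p.2))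
    (t * p.1)‖
  have hB : 0 ≤ B := norm_nonneg _
  -- On the annulus `|p₁| > 1/2`, so `|t| ≤ 2 |t p₁|`.
  have ht2 : |t| ^ a ≤ 2 ^ a * ‖t * p.1‖ ^ a := by
    rw [← mul_pow]
    refine pow_le_pow_left₀ (abs_nonneg _) ?_ _
    rw [norm_mul, Real.norm_eq_abs t]
    nlinarith [abs_nonneg t, hp.1.1]
  have hs2 : |s| ^ b ≤ 2 ^ b * ‖s * p.2‖ ^ b := by
    rw [← mul_pow]
    refine pow_le_pow_left₀ (abs_nonneg _) ?_ _
    rw [norm_mul, Real.norm_eq_abs s]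
    nlinarith [abs_nonneg s, hp.2.1]
  calc |t| ^ a * |s| ^ b * B ≤ (2 ^ a * ‖t * p.1‖ ^ a) * (2 ^ b * ‖s * p.2‖ ^ b) * B := by gcongr
    _ = 2 ^ N * (‖t * p.1‖ ^ a * ‖s * p.2‖ ^ b * B) := by rw [← hab, pow_add]; ring
    _ ≤ 2 ^ N * |C a b| := by gcongr; exact h2.trans (le_abs_self _)
    _ = 2 ^ N * |C a (N - a)| := by rw [show N - a = b by omega]
    _ ≤ _ := Finset.single_le_sum (f := fun i => 2 ^ N * |C i (N - i)|)
        (fun i _ => by positivity) (Finset.mem_range.2 (by omega))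

theorem contDiffOn_norm_pair :
    ContDiffOn ℝ ∞ (fun p : V × V => (‖p.1‖, ‖p.2‖)) (offAxesSet V) := fun _ hp =>
  ((contDiffAt_fst.norm ℝ hp.1).prodMk (contDiffAt_snd.norm ℝ hp.2)).contDiffWithinAt

variable [FiniteDimensional ℝ V]

/-- The closed annuli are compact and avoid the origin, where alone the norm fails to be smooth. -/
theorem exists_norm_iteratedFDeriv_norm_pair_le (i : ℕ) : ∃ B, ∀ p ∈ annulusPair V,
    ‖iteratedFDeriv ℝ i (fun p : V × V => (‖p.1‖, ‖p.2‖)) p‖ ≤ B := by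
  have : ProperSpace V := FiniteDimensional.proper_real V
  let K : Set (V × V) := (Metric.closedBall 0 2 ×ˢ Metric.closedBall 0 2) ∩
    {p | 1 / 2 ≤ ‖p.1‖ ∧ 1 / 2 ≤ ‖p.2‖}
  have hK : IsCompact K :=
    ((isCompact_closedBall _ _).prod (isCompact_closedBall _ _)).inter_right
      ((isClosed_le continuous_const continuous_fst.norm).inter
        (isClosed_le continuous_const continuous_snd.norm))
  have hc : ContinuousOn (iteratedFDeriv ℝ i (fun p : V × V => (‖p.1‖, ‖p.2‖))) K := by
    intro p hp
    have hp' : p ∈ offAxesSet V := ⟨norm_pos_iff.1 (by linarith [hp.2.1]),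
      norm_pos_iff.1 (by linarith [hp.2.2])⟩
    exact (differentiableAt_iteratedFDeriv_of_contDiffOn isOpen_offAxesSet contDiffOn_norm_pair i
      hp').continuousAt.continuousWithinAt
  obtain ⟨B, hB⟩ := hK.exists_bound_of_continuousOn hc
  refine ⟨B, fun p hp => hB p ⟨?_, hp.1.1.le, hp.2.1.le⟩⟩
  simpa using ⟨hp.1.2.le, hp.2.2.le⟩

theorem contDiffOn_radial_dilate {m : ℝ → ℝ → ℂ} (hm : MarcinkiewiczCondition m) (t s : ℝ) :
    ContDiffOn ℝ ∞ (fun q : V × V => offAxes m (t * ‖q.1‖) (s * ‖q.2‖)) (annulusPair V) := by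
  by_cases h : t ≠ 0 ∧ s ≠ 0
  · refine (hm.1.comp (f := fun q : V × V => (t * ‖q.1‖, s * ‖q.2‖)) (s := annulusPair V) ?_
      fun q hq => ?_).congr fun q hq => ?_
    · have := (contDiffOn_norm_pair (V := V)).mono annulusPair_subset
      exact (contDiffOn_const.mul this.fst).prodMk (contDiffOn_const.mul this.snd)
    · exact ⟨mul_ne_zero h.1 (norm_ne_zero_iff.2 (annulusPair_subset hq).1),
        mul_ne_zero h.2 (norm_ne_zero_iff.2 (annulusPair_subset hq).2)⟩
    · exact offAxes_of_ne (mul_ne_zero h.1 (norm_ne_zero_iff.2 (annulusPair_subset hq).1))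
        (mul_ne_zero h.2 (norm_ne_zero_iff.2 (annulusPair_subset hq).2))
  · refine (contDiffOn_const (c := (0 : ℂ))).congr fun q _ => ?_
    rcases not_and_or.1 h with h | h <;> rw [not_not.1 h, zero_mul]
    · exact offAxes_zero_left _ _
    · exact offAxes_zero_right _ _

/-- The composition bound for higher derivatives combines the uniform bounds on the dilates of `m`
with those on `(|ξ|, |η|)`. Zero dilations, which arise from `θ ⟂ e`, give the zero function. -/
theorem exists_norm_iteratedFDeriv_radial_dilate_le {m : ℝ → ℝ → ℂ}
    (hm : MarcinkiewiczCondition m) (N : ℕ) : ∃ C, ∀ t s : ℝ, ∀ p ∈ annulusPair V,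
      ‖iteratedFDeriv ℝ N (fun q : V × V => offAxes m (t * ‖q.1‖) (s * ‖q.2‖)) p‖ ≤ C := by
  choose C hC using exists_norm_iteratedFDeriv_dilate_le hm.offAxes
  choose B hB using exists_norm_iteratedFDeriv_norm_pair_le (V := V)
  let C' := ∑ i ∈ Finset.range (N + 1), |C i|
  -- The composition bound wants the `i`-th derivative below `D ^ i`; the summand `1` ensures `D ≤ D
  -- ^ i` for `i ≥ 1`.
  let D := 1 + ∑ i ∈ Finset.range (N + 1), |B i|
  have hC' : 0 ≤ C' := Finset.sum_nonneg fun _ _ => abs_nonneg _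
  have hD : 1 ≤ D := le_add_of_nonneg_right (Finset.sum_nonneg fun _ _ => abs_nonneg _)
  refine ⟨N.factorial * C' * D ^ N, fun t s p hp => ?_⟩
  by_cases h : t ≠ 0 ∧ s ≠ 0
  · have hg : ContDiffOn ℝ ∞ (fun q : ℝ × ℝ => offAxes m (t * q.1) (s * q.2)) (annulusPair ℝ) :=
      hm.offAxes.1.comp (f := fun q : ℝ × ℝ => (t * q.1, s * q.2)) (by fun_prop)
        fun q hq => ⟨mul_ne_zero h.1 (annulusPair_subset hq).1,
          mul_ne_zero h.2 (annulusPair_subset hq).2⟩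
    have := norm_iteratedFDerivWithin_comp_le (n := N) hg
      ((contDiffOn_norm_pair (V := V)).mono annulusPair_subset)
      (by exact_mod_cast le_top) isOpen_annulusPair.uniqueDiffOn isOpen_annulusPair.uniqueDiffOn
      (fun q hq => norm_mem_annulusPair hq) hp (C := C') (D := D) (fun i hi => ?_)
      fun i hi1 hi => ?_
    · rwa [iteratedFDerivWithin_of_isOpen N isOpen_annulusPair hp] at this
    · rw [iteratedFDerivWithin_of_isOpen i isOpen_annulusPair (norm_mem_annulusPair hp)]
      refine (hC i t s h.1 h.2 _ (norm_mem_annulusPair hp)).trans ((le_abs_self _).trans ?_)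
      exact Finset.single_le_sum (f := fun i => |C i|) (fun _ _ => abs_nonneg _)
        (Finset.mem_range.2 (by omega))
    · rw [iteratedFDerivWithin_of_isOpen i isOpen_annulusPair hp]
      have h1 : |B i| ≤ ∑ i ∈ Finset.range (N + 1), |B i| :=
        Finset.single_le_sum (f := fun i => |B i|) (fun _ _ => abs_nonneg _)
          (Finset.mem_range.2 (by omega))
      refine (hB i p hp).trans ((le_abs_self _).trans (h1.trans ?_))
      exact (show _ ≤ D by simp [D]).trans (le_self_pow₀ hD (by omega))
  · have : (fun q : V × V => offAxes m (t * ‖q.1‖) (s * ‖q.2‖)) = 0 := by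
      ext q
      rcases not_and_or.1 h with h | h <;> rw [not_not.1 h, zero_mul]
      · exact offAxes_zero_left _ _
      · exact offAxes_zero_right _ _
    rw [this, iteratedFDeriv_zero]
    simp only [Pi.zero_apply, norm_zero]
    positivity

/-- After rescaling `(ξ, η)` to unit vectors, the integrand is again a radial dilate of `m`, with
bounds independent of the scale and of `a`. Hence any finite measure and any measurable dilation
factors are allowed. -/
theorem MarcinkiewiczCondition.radial_average [MeasurableSpace V] [BorelSpace V]
    {A : Type*} [MeasurableSpace A] {μ : Measure A} [IsFiniteMeasure μ] {σ τ : A → ℝ}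
    (hσ : Measurable σ) (hτ : Measurable τ) {m : ℝ → ℝ → ℂ} (hm : MarcinkiewiczCondition m) :
    MarcinkiewiczCondition fun ξ η : V =>
      ∫ a, BilinearMultiplier.offAxes m (‖ξ‖ * σ a) (‖η‖ * τ a) ∂μ := by
  set M : V → V → ℂ := fun ξ η => ∫ a, BilinearMultiplier.offAxes m (‖ξ‖ * σ a) (‖η‖ * τ a) ∂μ
    with hM
  choose C hC using exists_norm_iteratedFDeriv_radial_dilate_le (V := V) hm
  have hdil : ∀ r s : ℝ, 0 < r → 0 < s → (fun p : V × V => M (r • p.1) (s • p.2)) =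
      fun p => ∫ a, BilinearMultiplier.offAxes m (r * σ a * ‖p.1‖) (s * τ a * ‖p.2‖) ∂μ := by
    intro r s hr hs
    ext p
    simp only [hM, norm_smul, Real.norm_of_nonneg hr.le, Real.norm_of_nonneg hs.le]
    congr! 3 <;> ring
  have hmeas : ∀ (r s : ℝ) (p : V × V), AEStronglyMeasurable
      (fun a => BilinearMultiplier.offAxes m (r * σ a * ‖p.1‖) (s * τ a * ‖p.2‖)) μ :=
    fun r s p => ((measurable_offAxes hm).comp
      (((hσ.const_mul r).mul_const _).prodMk ((hτ.const_mul s).mul_const _))).aestronglyMeasurable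
  have hsmooth : ∀ r s : ℝ, 0 < r → 0 < s →
      ContDiffOn ℝ ∞ (fun p : V × V => M (r • p.1) (s • p.2)) (annulusPair V) := by
    intro r s hr hs
    rw [hdil r s hr hs]
    exact (hasFTaylorSeriesUpToOn_integral isOpen_annulusPair
      (fun a => contDiffOn_radial_dilate hm (r * σ a) (s * τ a)) (fun p _ => hmeas r s p)
      (fun l a p hp => hC l _ _ p hp)).contDiffOn
  have hbound : ∀ (N : ℕ) (r s : ℝ), 0 < r → 0 < s → ∀ p ∈ annulusPair V,
      ‖iteratedFDeriv ℝ N (fun p : V × V => M (r • p.1) (s • p.2)) p‖ ≤ C N * μ.real univ := by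
    intro N r s hr hs p hp
    rw [hdil r s hr hs]
    exact norm_iteratedFDeriv_integral_le isOpen_annulusPair
      (fun a => contDiffOn_radial_dilate hm (r * σ a) (s * τ a)) (fun p _ => hmeas r s p)
      (fun l a p hp => hC l _ _ p hp) N hp
  have hunit : ∀ {ξ η : V}, ξ ≠ 0 → η ≠ 0 → (‖ξ‖⁻¹ • ξ, ‖η‖⁻¹ • η) ∈ annulusPair V := by
    intro ξ η hξ hη
    simp [annulusPair, norm_smul, hξ, hη]
    norm_num
  have hback : ∀ {ξ : V}, ξ ≠ 0 → ∀ x : V, ‖ξ‖ • ‖ξ‖⁻¹ • x = x := fun hξ x => by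
    rw [smul_smul, mul_inv_cancel₀ (norm_ne_zero_iff.2 hξ), one_smul]
  refine ⟨fun p hp => ContDiffAt.contDiffWithinAt ?_, fun a b => ⟨C (a + b) * μ.real univ,
    fun ξ η hξ hη => ?_⟩⟩
  · have h1 := (hsmooth ‖p.1‖ ‖p.2‖ (norm_pos_iff.2 hp.1) (norm_pos_iff.2 hp.2)).contDiffAt
      (isOpen_annulusPair.mem_nhds (hunit hp.1 hp.2))
    have h2 : ContDiffAt ℝ ∞ (fun q : V × V => (‖p.1‖⁻¹ • q.1, ‖p.2‖⁻¹ • q.2)) p := by fun_prop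
    have h3 := ContDiffAt.comp p h1 h2
    refine h3.congr_of_eventuallyEq (Eventually.of_forall fun q => ?_)
    simp only [Function.comp_apply, hback hp.1, hback hp.2]
    rfl
  -- The weighted derivative at `(ξ, η)` equals the unweighted derivative of the rescaled function
  -- at the unit vectors.
  · have hd := norm_iteratedFDeriv_iteratedFDeriv_dilate (norm_ne_zero_iff.2 hξ)
      (norm_ne_zero_iff.2 hη) M a b (‖ξ‖⁻¹ • ξ) (‖η‖⁻¹ • η)
    rw [hback hξ, hback hη, abs_of_nonneg (norm_nonneg ξ), abs_of_nonneg (norm_nonneg η)] at hd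
    refine hd.symm.le.trans ?_
    refine (norm_iteratedFDeriv_iteratedFDeriv_slice_le isOpen_annulusPair
      (hsmooth ‖ξ‖ ‖η‖ (norm_pos_iff.2 hξ) (norm_pos_iff.2 hη)) a b (hunit hξ hη)).trans ?_
    exact hbound (a + b) ‖ξ‖ ‖η‖ (norm_pos_iff.2 hξ) (norm_pos_iff.2 hη) _ (hunit hξ hη)

end radial

/-! ### From Schwartz test functions to bounded measurable ones. -/

section density

variable {W : Type*} [NormedAddCommGroup W] [InnerProductSpace ℝ W] [FiniteDimensional ℝ W]
  [MeasurableSpace W] [BorelSpace W] {X : Type*} [MeasurableSpace X] {μ : Measure X}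

/-- If two complex measures, one with density `F` and one the image under `T` of a measure with
density `G`, agree on Schwartz functions, then they agree on bounded measurable functions. -/
theorem integral_mul_eq_of_schwartz {F : W → ℂ} (hF : Integrable F) {G : X → ℂ}
    (hG : Integrable G μ) {T : X → W} (hT : Measurable T)
    (h : ∀ ψ : 𝓢(W, ℂ), ∫ w, ψ w * F w = ∫ x, ψ (T x) * G x ∂μ)
    {m : W → ℂ} (hm : Measurable m) {C : ℝ} (hC : ∀ w, ‖m w‖ ≤ C) :
    ∫ w, m w * F w = ∫ x, m (T x) * G x ∂μ := by
  -- The finite measures `ν₁`, `ν₂` dominate the two complex measures, so one smooth compactly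
  -- supported approximation of `m` in `L¹(ν₁ + ν₂)` controls both sides at once.
  let ν₁ : Measure W := volume.withDensity fun w => ‖F w‖ₑ
  let ν₂ : Measure W := (μ.withDensity fun x => ‖G x‖ₑ).map T
  have : IsFiniteMeasure (volume.withDensity fun w => ‖F w‖ₑ) :=
    isFiniteMeasure_withDensity hF.2.ne
  have : IsFiniteMeasure (μ.withDensity fun x => ‖G x‖ₑ) := isFiniteMeasure_withDensity hG.2.ne
  have hmL : MemLp m 1 (ν₁ + ν₂) :=
    memLp_one_iff_integrable.2 ((integrable_const C).mono' hm.aestronglyMeasurable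
      (Eventually.of_forall hC))
  have hbd : ∀ ε : ℝ, 0 < ε → ‖(∫ w, m w * F w) - ∫ x, m (T x) * G x ∂μ‖ ≤ ε + ε := by
    intro ε hε
    obtain ⟨g, hg1, hg2, hg3⟩ := hmL.exist_eLpNorm_sub_le ENNReal.one_ne_top le_rfl hε
    let ψ : 𝓢(W, ℂ) := hg1.toSchwartzMap hg2
    have hψm : Measurable ψ := ψ.continuous.measurable
    obtain ⟨B, hB⟩ : ∃ B, ∀ w, ‖ψ w‖ ≤ B := ⟨_, fun w => norm_le_seminorm ℂ ψ w⟩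
    have hd : Measurable fun w => ‖m w - ψ w‖ₑ := (hm.sub hψm).enorm
    rw [eLpNorm_one_eq_lintegral_enorm] at hg3
    have hsum : ∫⁻ w, ‖m w - ψ w‖ₑ ∂ν₁ + ∫⁻ w, ‖m w - ψ w‖ₑ ∂ν₂ ≤ ENNReal.ofReal ε := by
      rw [← lintegral_add_measure]; exact hg3
    have i1 : Integrable (fun w => m w * F w) := hF.bdd_mul hm.aestronglyMeasurable
      (Eventually.of_forall hC)
    have i2 : Integrable (fun w => ψ w * F w) := hF.bdd_mul hψm.aestronglyMeasurable
      (Eventually.of_forall hB)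
    have i3 : Integrable (fun x => m (T x) * G x) μ :=
      hG.bdd_mul (hm.comp hT).aestronglyMeasurable (Eventually.of_forall fun x => hC _)
    have i4 : Integrable (fun x => ψ (T x) * G x) μ :=
      hG.bdd_mul (hψm.comp hT).aestronglyMeasurable (Eventually.of_forall fun x => hB _)
    have e1 : ‖∫ w, (m w * F w - ψ w * F w)‖ ≤ ε := by
      rw [← ENNReal.ofReal_le_ofReal_iff hε.le, ofReal_norm]
      refine (enorm_integral_le_lintegral_enorm _).trans (le_trans ?_ (le_self_add.trans hsum))
      rw [lintegral_withDensity_eq_lintegral_mul₀ hF.1.enorm hd.aemeasurable]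
      refine lintegral_mono fun w => ?_
      rw [← sub_mul, enorm_mul, Pi.mul_apply, mul_comm]
    have e2 : ‖∫ x, (m (T x) * G x - ψ (T x) * G x) ∂μ‖ ≤ ε := by
      rw [← ENNReal.ofReal_le_ofReal_iff hε.le, ofReal_norm]
      refine (enorm_integral_le_lintegral_enorm _).trans (le_trans ?_ (le_add_self.trans hsum))
      rw [lintegral_map hd hT,
        lintegral_withDensity_eq_lintegral_mul₀ hG.1.enorm (g := fun x => ‖m (T x) - ψ (T x)‖ₑ)
          (hd.comp hT).aemeasurable]
      refine lintegral_mono fun x => ?_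
      simp only [Pi.mul_apply, ← sub_mul, enorm_mul]
      rw [mul_comm]
    rw [integral_sub i1 i2] at e1
    rw [integral_sub i3 i4, ← h ψ] at e2
    have := norm_sub_le_of_le e1 e2
    rwa [sub_sub_sub_cancel_right] at this
  refine sub_eq_zero.1 (norm_le_zero_iff.1 (le_of_forall_pos_le_add fun ε hε => ?_))
  simpa using hbd (ε / 2) (half_pos hε)

end density

/-! ### Rotation invariance of the surface measure. -/

section rotation

variable {V : Type*} [NormedAddCommGroup V] [InnerProductSpace ℝ V] [FiniteDimensional ℝ V]
  [MeasurableSpace V] [BorelSpace V]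

/-- The action of a linear isometry on the unit sphere. -/
def sphereMap (R : V ≃ₗᵢ[ℝ] V) (θ : Metric.sphere (0 : V) 1) : Metric.sphere (0 : V) 1 :=
  ⟨R θ, by simp⟩

/-- Surface measure is, up to a constant, the volume of the cone over a set; isometries preserve
volume and map cones to cones. -/
theorem measurePreserving_sphereMap (R : V ≃ₗᵢ[ℝ] V) :
    MeasurePreserving (sphereMap R) (volume : Measure V).toSphere
      (volume : Measure V).toSphere := by
  have hc : Continuous (sphereMap R) := by
    unfold sphereMap
    fun_prop
  refine ⟨hc.measurable, ?_⟩
  ext s hs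
  rw [Measure.map_apply hc.measurable hs, Measure.toSphere_apply' _ hs,
    Measure.toSphere_apply' _ (hc.measurable hs)]
  congr 1
  rw [← R.measurePreserving.measure_preimage_equiv (f := R.toMeasurableEquiv)
    (Ioo (0 : ℝ) 1 • (Subtype.val '' s))]
  congr 1
  ext x
  simp only [Set.mem_smul, mem_image, mem_preimage]
  constructor
  · rintro ⟨r, hr, _, ⟨θ, hθ, rfl⟩, rfl⟩
    exact ⟨r, hr, _, ⟨sphereMap R θ, hθ, rfl⟩, by simp [sphereMap]⟩
  · rintro ⟨r, hr, _, ⟨θ, hθ, rfl⟩, hx⟩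
    refine ⟨r, hr, _, ⟨sphereMap R.symm θ, ?_, rfl⟩, ?_⟩
    · have : sphereMap R (sphereMap R.symm θ) = θ := by ext; simp [sphereMap]
      rwa [this]
    · apply R.injective
      rw [map_smul]
      simpa [sphereMap] using hx

/-- The reflection exchanging `|ξ| e` and `ξ`, which have equal norms, does it. -/
theorem exists_inner_sphereMap (e : Metric.sphere (0 : V) 1) (ξ : V) :
    ∃ R : V ≃ₗᵢ[ℝ] V, ∀ θ, ⟪ξ, (sphereMap R θ : V)⟫ = ‖ξ‖ * ⟪(e : V), (θ : V)⟫ := by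
  have hn : ‖‖ξ‖ • (e : V)‖ = ‖ξ‖ := by simp [norm_smul]
  refine ⟨(ℝ ∙ (‖ξ‖ • (e : V) - ξ))ᗮ.reflection, fun θ => ?_⟩
  have h := Submodule.reflection_sub hn
  change ⟪ξ, (ℝ ∙ (‖ξ‖ • (e : V) - ξ))ᗮ.reflection θ⟫ = _
  have h' := (ℝ ∙ (‖ξ‖ • (e : V) - ξ))ᗮ.reflection.inner_map_map (‖ξ‖ • (e : V)) θ
  rwa [h, real_inner_smul_left] at h'

/-- The two spheres can be rotated independently, since the measure is a product. -/
theorem integral_spherePair_inner (e : Metric.sphere (0 : V) 1) {g : ℝ → ℝ → ℂ}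
    (hg : Measurable (Function.uncurry g)) (ξ η : V) :
    ∫ a, g ⟪ξ, (a.1 : V)⟫ ⟪η, (a.2 : V)⟫ ∂(spherePairMeasure V) =
      ∫ a, g (‖ξ‖ * ⟪(e : V), (a.1 : V)⟫) (‖η‖ * ⟪(e : V), (a.2 : V)⟫)
        ∂(spherePairMeasure V) := by
  obtain ⟨R, hR⟩ := exists_inner_sphereMap e ξ
  obtain ⟨R', hR'⟩ := exists_inner_sphereMap e η
  have hp := (measurePreserving_sphereMap R).prod (measurePreserving_sphereMap R')
  have hmeas : Measurable fun a : Metric.sphere (0 : V) 1 × Metric.sphere (0 : V) 1 =>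
      g ⟪ξ, (a.1 : V)⟫ ⟪η, (a.2 : V)⟫ := by
    refine hg.comp (Measurable.prodMk ?_ ?_)
    · exact (continuous_const.inner continuous_subtype_val).measurable.comp measurable_fst
    · exact (continuous_const.inner continuous_subtype_val).measurable.comp measurable_snd
  rw [spherePairMeasure]
  conv_lhs => rw [← hp.map_eq]
  rw [integral_map hp.measurable.aemeasurable hmeas.aestronglyMeasurable]
  simp only [Prod.map_fst, Prod.map_snd, hR, hR']

end rotation

/-! ### The Fourier slice formula and the symbol of the radial kernel. -/

section slice

variable {V : Type*} [NormedAddCommGroup V] [InnerProductSpace ℝ V] [FiniteDimensional ℝ V]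
  [MeasurableSpace V] [BorelSpace V]

/-- This is the multiplication formula `∫ χ φ̂ = ∫ χ̂ φ` for the pairing `(w, q) ↦ ⟨w, J q⟩` between
spaces of possibly different dimensions: restriction along `J` is dual to composition with its
adjoint `J'`. -/
theorem integral_mul_fourier_comp {W₁ W₂ : Type*} [NormedAddCommGroup W₁] [InnerProductSpace ℝ W₁]
    [FiniteDimensional ℝ W₁] [MeasurableSpace W₁] [BorelSpace W₁] [NormedAddCommGroup W₂]
    [InnerProductSpace ℝ W₂] [FiniteDimensional ℝ W₂] [MeasurableSpace W₂] [BorelSpace W₂]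
    (J : W₁ →ₗᵢ[ℝ] W₂) (J' : W₂ → W₁) (hJ : ∀ w q, ⟪w, J q⟫ = ⟪J' w, q⟫)
    (χ : 𝓢(W₁, ℂ)) (φ : 𝓢(W₂, ℂ)) :
    ∫ q, χ q * 𝓕 φ (J q) = ∫ w, 𝓕 χ (J' w) * φ w := by
  let L : W₂ →ₗ[ℝ] W₁ →ₗ[ℝ] ℝ := (innerₗ W₂).compl₂ J.toLinearMap
  have hL : Continuous fun p : W₂ × W₁ => L p.1 p.2 :=
    continuous_fst.inner (J.continuous.comp continuous_snd)
  have h := VectorFourier.integral_fourierIntegral_smul_eq_flip (L := L)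
    (μ := (volume : Measure W₂)) (ν := (volume : Measure W₁)) Real.continuous_fourierChar hL
    φ.integrable χ.integrable
  simp only [smul_eq_mul] at h
  have h1 : ∀ q, VectorFourier.fourierIntegral Real.fourierChar volume L φ q = 𝓕 φ (J q) := by
    intro q
    rw [fourier_coe, Real.fourier_eq]
    rfl
  have h2 : ∀ w, VectorFourier.fourierIntegral Real.fourierChar volume L.flip χ w =
      𝓕 χ (J' w) := by
    intro w
    rw [fourier_coe, Real.fourier_eq]
    refine integral_congr_ae (Eventually.of_forall fun q => ?_)
    change Real.fourierChar (-⟪w, J q⟫) • _ = _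
    rw [hJ, real_inner_comm]
  simp only [h1, h2] at h
  simpa only [mul_comm] using h

/-- The adjoint of `rayPair`, jointly in all variables. -/
def rayPairAdjoint (p : WithLp 2 (V × V) × (Metric.sphere (0 : V) 1 × Metric.sphere (0 : V) 1)) :
    WithLp 2 (ℝ × ℝ) :=
  WithLp.toLp 2 (⟪p.1.fst, (p.2.1 : V)⟫, ⟪p.1.snd, (p.2.2 : V)⟫)

theorem inner_rayPair (w : WithLp 2 (V × V))
    (a : Metric.sphere (0 : V) 1 × Metric.sphere (0 : V) 1) (q : WithLp 2 (ℝ × ℝ)) :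
    ⟪w, rayPair a q⟫ = ⟪rayPairAdjoint (w, a), q⟫ := by
  change ⟪w, WithLp.toLp 2 (q.fst • (a.1 : V), q.snd • (a.2 : V))⟫ = _
  simp [WithLp.prod_inner_apply, rayPairAdjoint, inner_smul_right]

theorem continuous_fst_withLp : Continuous fun w : WithLp 2 (V × V) => w.fst :=
  (WithLp.fstL 2 ℝ V V).continuous

theorem continuous_snd_withLp : Continuous fun w : WithLp 2 (V × V) => w.snd :=
  (WithLp.sndL 2 ℝ V V).continuous

theorem continuous_rayPairAdjoint : Continuous (rayPairAdjoint (V := V)) := by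
  refine (WithLp.prod_continuous_toLp 2 ℝ ℝ).comp (Continuous.prodMk ?_ ?_)
  · exact (continuous_fst_withLp.comp continuous_fst).inner
      (continuous_subtype_val.comp (continuous_fst.comp continuous_snd))
  · exact (continuous_snd_withLp.comp continuous_fst).inner
      (continuous_subtype_val.comp (continuous_snd.comp continuous_snd))

theorem continuous_rayPair : Continuous fun p : WithLp 2 (ℝ × ℝ) ×
    (Metric.sphere (0 : V) 1 × Metric.sphere (0 : V) 1) => rayPair p.2 p.1 := by
  change Continuous fun p : WithLp 2 (ℝ × ℝ) ×
    (Metric.sphere (0 : V) 1 × Metric.sphere (0 : V) 1) =>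
      WithLp.toLp 2 (p.1.fst • (p.2.1 : V), p.1.snd • (p.2.2 : V))
  refine (WithLp.prod_continuous_toLp 2 V V).comp (Continuous.prodMk ?_ ?_)
  · exact (continuous_fst_withLp.comp continuous_fst).smul
      (continuous_subtype_val.comp (continuous_fst.comp continuous_snd))
  · exact (continuous_snd_withLp.comp continuous_fst).smul
      (continuous_subtype_val.comp (continuous_snd.comp continuous_snd))

theorem sphereIntegral_eq_integral_rayPair (φ : 𝓢(WithLp 2 (V × V), ℂ)) (q : WithLp 2 (ℝ × ℝ)) :
    sphereIntegral V φ q = ∫ a, φ (rayPair a q) ∂(spherePairMeasure V) := by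
  change ∫ a, (1 : ℂ) * φ (0 + rayPair a q) ∂(spherePairMeasure V) = _
  simp only [one_mul, zero_add]

/-- Moving `𝓕⁻` onto `ψ` and applying the slice formula for each pair of directions turns `𝓕 (𝓕⁻ ψ)`
back into `ψ`. In measure terms, on Schwartz functions the density `𝓕⁻ Φ`, with `Φ` built from `𝓕
φ`, is the image under `rayPairAdjoint` of `φ dw dσ dσ`. -/
theorem integral_mul_fourierInv_sphereIntegral (φ : 𝓢(WithLp 2 (V × V), ℂ))
    (ψ : 𝓢(WithLp 2 (ℝ × ℝ), ℂ)) :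
    ∫ q, ψ q * 𝓕⁻ (sphereIntegral V (𝓕 φ)) q =
      ∫ p, ψ (rayPairAdjoint p) * φ p.1
        ∂((volume : Measure (WithLp 2 (V × V))).prod (spherePairMeasure V)) := by
  have : ProperSpace V := FiniteDimensional.proper_real V
  have : SecondCountableTopology V := secondCountable_of_proper
  have hχ : 𝓕 (𝓕⁻ ψ) = ψ := FourierTransform.fourier_fourierInv_eq ψ
  rw [← integral_fourierInv_mul_eq]
  simp only [sphereIntegral_eq_integral_rayPair, ← integral_const_mul]
  rw [integral_integral_swap]
  · have hstep : ∀ a : Metric.sphere (0 : V) 1 × Metric.sphere (0 : V) 1,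
        ∫ q, 𝓕⁻ ψ q * 𝓕 φ (rayPair a q) = ∫ w, ψ (rayPairAdjoint (w, a)) * φ w := by
      intro a
      rw [integral_mul_fourier_comp (rayPair a) (fun w => rayPairAdjoint (w, a))
        (fun w q => inner_rayPair w a q), hχ]
    simp only [hstep]
    refine (integral_prod_symm (μ := volume) (ν := spherePairMeasure V)
      (fun p => ψ (rayPairAdjoint p) * φ p.1) ?_).symm
    refine ((φ.integrable (μ := volume)).norm.mul_prod
      (integrable_const (μ := spherePairMeasure V) (SchwartzMap.seminorm ℂ 0 0 ψ))).mono'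
      ?_ (Eventually.of_forall fun p => ?_)
    · exact ((ψ.continuous.comp continuous_rayPairAdjoint).mul
        (φ.continuous.comp continuous_fst)).aestronglyMeasurable
    · rw [norm_mul, mul_comm]
      gcongr
      exact norm_le_seminorm ℂ ψ _
  · refine (((𝓕⁻ ψ).integrable (μ := volume)).norm.mul_prod
      (integrable_const (μ := spherePairMeasure V) (SchwartzMap.seminorm ℂ 0 0 (𝓕 φ)))).mono'
      ?_ (Eventually.of_forall fun p => ?_)
    · exact (((𝓕⁻ ψ).continuous.comp continuous_fst).mul
        ((𝓕 φ).continuous.comp continuous_rayPair)).aestronglyMeasurable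
    · simp only [Function.uncurry, norm_mul]
      gcongr
      exact norm_le_seminorm ℂ (𝓕 φ) _

/-- The axes are proper subspaces, hence null. -/
theorem ae_offAxes_eq (m : ℝ → ℝ → ℂ) :
    ∀ᵐ q : WithLp 2 (ℝ × ℝ), m q.fst q.snd = offAxes m q.fst q.snd := by
  have h1 : volume ((WithLp.fstL 2 ℝ ℝ ℝ).ker : Set (WithLp 2 (ℝ × ℝ))) = 0 := by
    refine Measure.addHaar_submodule _ _ fun h => ?_
    have : WithLp.toLp 2 ((1 : ℝ), (0 : ℝ)) ∈ (WithLp.fstL 2 ℝ ℝ ℝ).ker := h ▸ trivial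
    simp at this
  have h2 : volume ((WithLp.sndL 2 ℝ ℝ ℝ).ker : Set (WithLp 2 (ℝ × ℝ))) = 0 := by
    refine Measure.addHaar_submodule _ _ fun h => ?_
    have : WithLp.toLp 2 ((0 : ℝ), (1 : ℝ)) ∈ (WithLp.sndL 2 ℝ ℝ ℝ).ker := h ▸ trivial
    simp at this
  filter_upwards [measure_eq_zero_iff_ae_notMem.1 h1, measure_eq_zero_iff_ae_notMem.1 h2]
    with q hq1 hq2
  exact (offAxes_of_ne hq1 hq2).symm

variable (V) in
theorem fourier_radialKernel_apply {K : 𝓢'(WithLp 2 (ℝ × ℝ), ℂ)} {m : ℝ → ℝ → ℂ}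
    (hm : MarcinkiewiczCondition m)
    (hK : ∀ φ : 𝓢(WithLp 2 (ℝ × ℝ), ℂ), 𝓕 K φ = ∫ p : WithLp 2 (ℝ × ℝ), m p.fst p.snd * φ p)
    (φ : 𝓢(WithLp 2 (V × V), ℂ)) :
    𝓕 (radialKernel V K) φ = ∫ w : WithLp 2 (V × V), (1 / 4 : ℂ) *
      (∫ a, offAxes m ⟪w.fst, (a.1 : V)⟫ ⟪w.snd, (a.2 : V)⟫ ∂(spherePairMeasure V)) * φ w := by
  have : ProperSpace V := FiniteDimensional.proper_real V
  have : SecondCountableTopology V := secondCountable_of_proper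
  obtain ⟨C, hC⟩ := exists_norm_offAxes_le hm
  -- Fourier inversion makes the formula for `𝓕 K` usable on `K` itself.
  have hinv : ∀ Ψ : 𝓢(WithLp 2 (ℝ × ℝ), ℂ), K Ψ = 𝓕 K (𝓕⁻ Ψ) := fun Ψ => by
    rw [TemperedDistribution.fourier_apply, FourierTransform.fourier_fourierInv_eq]
  have hmeas : Measurable fun q : WithLp 2 (ℝ × ℝ) => offAxes m q.fst q.snd :=
    (measurable_offAxes hm).comp
      ((continuous_fst_withLp (V := ℝ)).measurable.prodMk
        (continuous_snd_withLp (V := ℝ)).measurable)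
  have hint : Integrable (fun p : WithLp 2 (V × V) ×
      (Metric.sphere (0 : V) 1 × Metric.sphere (0 : V) 1) => φ p.1)
      ((volume : Measure (WithLp 2 (V × V))).prod (spherePairMeasure V)) := by
    simpa using (φ.integrable (μ := volume)).mul_prod
      (integrable_const (μ := spherePairMeasure V) (1 : ℂ))
  -- The slice identity, known for Schwartz `ψ`, is extended to the bounded measurable `offAxes m`.
  have key := integral_mul_eq_of_schwartz (𝓕⁻ (sphereIntegral V (𝓕 φ))).integrable hint
    continuous_rayPairAdjoint.measurable (integral_mul_fourierInv_sphereIntegral φ) hmeas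
    fun q => hC _ _
  rw [TemperedDistribution.fourier_apply, radialKernel_apply, hinv, hK]
  have e1 : ∫ q : WithLp 2 (ℝ × ℝ), m q.fst q.snd * 𝓕⁻ (sphereIntegral V (𝓕 φ)) q =
      ∫ q : WithLp 2 (ℝ × ℝ), offAxes m q.fst q.snd * 𝓕⁻ (sphereIntegral V (𝓕 φ)) q := by
    refine integral_congr_ae ?_
    filter_upwards [ae_offAxes_eq m] with q hq
    rw [hq]
  rw [e1, key, integral_prod]
  · simp only [mul_assoc, integral_const_mul]
    congr 1
    refine integral_congr_ae (Eventually.of_forall fun w => ?_)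
    simp only [integral_mul_const]
    rfl
  · exact hint.bdd_mul (hmeas.comp continuous_rayPairAdjoint.measurable).aestronglyMeasurable
      (Eventually.of_forall fun p => hC _ _)

end slice

/-! ### The Fourier transform of the kernel test function, and the conclusion. -/

section kernelTest

variable {V : Type*} [NormedAddCommGroup V] [InnerProductSpace ℝ V] [FiniteDimensional ℝ V]
  [MeasurableSpace V] [BorelSpace V]

theorem fourier_tensor_apply (f g : 𝓢(V, ℂ)) (p : WithLp 2 (V × V)) :
    𝓕 (tensor f g) p = 𝓕 f p.fst * 𝓕 g p.snd := by
  simp only [fourier_coe, Real.fourier_eq]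
  rw [← integral_prod_mul, ← Measure.volume_eq_prod,
    ← (WithLp.volume_preserving_toLp V V).integral_comp
      (MeasurableEquiv.toLp 2 (V × V)).measurableEmbedding]
  refine integral_congr_ae (Eventually.of_forall fun z => ?_)
  simp only [Circle.smul_def, smul_eq_mul, tensor_apply, WithLp.prod_inner_apply]
  rw [neg_add, AddChar.map_add_eq_mul, Circle.coe_mul]
  change (Real.fourierChar (-⟪z.1, p.fst⟫) : ℂ) * (Real.fourierChar (-⟪z.2, p.snd⟫) : ℂ) *
    (f z.1 * g z.2) = _
  ring

/-- For fixed `x` the `L¹` norm in `w` is that of `f ⊗ g`, by reflection and translation invariance,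
leaving the integrable factor `|h(x)|`. -/
theorem integrable_kernelTest (f g h : 𝓢(V, ℂ)) :
    Integrable (fun z : WithLp 2 (V × V) × V =>
      h z.2 * tensor f g (WithLp.toLp 2 (z.2, z.2) - z.1)) (volume.prod volume) := by
  have : ProperSpace V := FiniteDimensional.proper_real V
  have : SecondCountableTopology V := secondCountable_of_proper
  have hc : Continuous fun z : WithLp 2 (V × V) × V =>
      h z.2 * tensor f g (WithLp.toLp 2 (z.2, z.2) - z.1) := by
    refine (h.continuous.comp continuous_snd).mul ((tensor f g).continuous.comp ?_)
    exact ((WithLp.prod_continuous_toLp 2 V V).comp (by fun_prop)).sub continuous_fst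
  rw [integrable_prod_iff' hc.aestronglyMeasurable]
  refine ⟨Eventually.of_forall fun x =>
    ((tensor f g).integrable.comp_sub_left (WithLp.toLp 2 (x, x))).const_mul (h x), ?_⟩
  simp only [norm_mul, integral_const_mul]
  have : ∀ x : V, ∫ w, ‖tensor f g (WithLp.toLp 2 (x, x) - w)‖ = ∫ w, ‖tensor f g w‖ :=
    fun x => integral_sub_left_eq_self (fun w => ‖tensor f g w‖) volume _
  simp only [this]
  exact h.integrable.norm.mul_const _

/-- The kernel test function superposes, with weights `h(x)`, the reflected translates of `f ⊗ g` by
`(x, x)`. Reflection turns `𝓕⁻` into `𝓕`, and translation contributes the character `e^{2πi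
x·(ξ+η)}`, which integrates against `h` to `ȟ(ξ + η)`. -/
theorem fourierInv_kernelTest_apply (f g h : 𝓢(V, ℂ)) (p : WithLp 2 (V × V)) :
    𝓕⁻ (kernelTest f g h) p = 𝓕 f p.fst * 𝓕 g p.snd * 𝓕⁻ h (p.fst + p.snd) := by
  have : ProperSpace V := FiniteDimensional.proper_real V
  have : SecondCountableTopology V := secondCountable_of_proper
  have hk : ∀ w, kernelTest f g h w =
      ∫ x, h x * tensor f g (WithLp.toLp 2 (x, x) - w) := fun w => by
    rw [kernelTest_apply]
    refine integral_congr_ae (Eventually.of_forall fun x => ?_)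
    simp [mul_comm]
  rw [fourierInv_coe, Real.fourierInv_eq]
  simp only [hk, Circle.smul_def, smul_eq_mul, ← integral_const_mul]
  rw [integral_integral_swap]
  · have hx : ∀ x : V, ∫ w : WithLp 2 (V × V), (Real.fourierChar ⟪w, p⟫ : ℂ) *
        (h x * tensor f g (WithLp.toLp 2 (x, x) - w)) =
        𝓕 (tensor f g) p * ((Real.fourierChar ⟪x, p.fst + p.snd⟫ : ℂ) * h x) := by
      intro x
      rw [← integral_sub_left_eq_self _ volume (WithLp.toLp 2 (x, x)), fourier_coe,
        Real.fourier_eq, ← integral_mul_const]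
      refine integral_congr_ae (Eventually.of_forall fun w => ?_)
      have hi : ⟪WithLp.toLp 2 (x, x) - w, p⟫ = -⟪w, p⟫ + ⟪x, p.fst + p.snd⟫ := by
        rw [inner_sub_left, inner_add_right, WithLp.prod_inner_apply (WithLp.toLp 2 (x, x))]
        simp only [WithLp.fst, WithLp.snd]
        ring
      simp only [sub_sub_cancel, hi, Circle.smul_def, smul_eq_mul]
      rw [AddChar.map_add_eq_mul, Circle.coe_mul]
      ring
    simp only [hx]
    rw [integral_const_mul, fourier_tensor_apply, fourierInv_coe, Real.fourierInv_eq]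
    rfl
  · refine (integrable_kernelTest f g h).norm.mono' ?_ (Eventually.of_forall fun z => ?_)
    · refine Continuous.aestronglyMeasurable ?_
      refine Continuous.mul ?_ ((h.continuous.comp continuous_snd).mul
        ((tensor f g).continuous.comp ?_))
      · exact continuous_induced_dom.comp (Real.continuous_fourierChar.comp
          (continuous_fst.inner continuous_const))
      · exact ((WithLp.prod_continuous_toLp 2 V V).comp (by fun_prop)).sub continuous_fst
    · simp only [Function.uncurry, norm_mul, Circle.norm_coe, one_mul, le_refl]

end kernelTest

/-- The symbol of the radial kernel on `V × V` is
`M(ξ, η) = (1/4) ∫∫ m(⟨ξ, θ⟩, ⟨η, θ'⟩) dσ(θ) dσ(θ') = (1/4) ∫∫ m(|ξ| θ₁, |η| θ'₁) dσ(θ) dσ(θ')`,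
where `m` is the symbol of `K`. It inherits the Marcinkiewicz condition from `m` since the condition
is invariant under the dilations `m(s ·, t ·)`; this works in every positive dimension, and does not
use that `K` is bi-even, because `M` only sees the bi-even part of `m`. -/
theorem IsMarcinkiewiczMultiplier.radialKernel (V : Type*) [NormedAddCommGroup V]
    [InnerProductSpace ℝ V] [FiniteDimensional ℝ V] [MeasurableSpace V] [BorelSpace V]
    [Nontrivial V] {K : 𝓢'(WithLp 2 (ℝ × ℝ), ℂ)} (hK : IsMarcinkiewiczMultiplier K) :
    IsMarcinkiewiczMultiplier (BilinearMultiplier.radialKernel V K) := by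
  obtain ⟨m, hm, hKm, -⟩ := hK
  have : Nonempty (Metric.sphere (0 : V) 1) :=
    (NormedSpace.sphere_nonempty (E := V) (x := 0) (r := 1)).2 zero_le_one |>.to_subtype
  obtain ⟨e⟩ := this
  let σ : Metric.sphere (0 : V) 1 → ℝ := fun θ => ⟪(e : V), (θ : V)⟫
  have hσ : Measurable σ := (continuous_const.inner continuous_subtype_val).measurable
  -- The factor `1/4` is absorbed into the measure, so that `M` is literally a radial average.
  let M : V → V → ℂ := fun ξ η => ∫ a, offAxes m (‖ξ‖ * σ a.1) (‖η‖ * σ a.2)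
    ∂((1 / 4 : NNReal) • spherePairMeasure V)
  have hM : ∀ ξ η : V, M ξ η = (1 / 4 : ℂ) *
      ∫ a, offAxes m ⟪ξ, (a.1 : V)⟫ ⟪η, (a.2 : V)⟫ ∂(spherePairMeasure V) := by
    intro ξ η
    rw [integral_spherePair_inner e (measurable_offAxes hm)]
    simp only [M, σ, integral_smul_nnreal_measure]
    rw [NNReal.smul_def, Complex.real_smul]
    simp
  have hF : ∀ φ : 𝓢(WithLp 2 (V × V), ℂ), 𝓕 (BilinearMultiplier.radialKernel V K) φ =
      ∫ p : WithLp 2 (V × V), M p.fst p.snd * φ p := fun φ => by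
    simp only [fourier_radialKernel_apply V hm hKm, hM]
  refine ⟨M, hm.radial_average (hσ.comp measurable_fst) (hσ.comp measurable_snd), hF,
    fun f g h => ?_⟩
  -- Testing the symbol identity here undoes the Fourier transform on the left and leaves the kernel
  -- paired with `kernelTest f g h`, which is the bilinear form.
  have h1 := hF (𝓕⁻ (kernelTest f g h))
  rw [TemperedDistribution.fourier_apply, FourierTransform.fourier_fourierInv_eq] at h1
  rw [bilinearOp_apply, h1]
  simp only [fourierInv_kernelTest_apply]

end

end BilinearMultiplier

theorem mainTheorem3 (K : 𝓢'(WithLp 2 (ℝ × ℝ), ℂ)) (heven : BilinearMultiplier.IsBiEven K)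
    (hK : BilinearMultiplier.IsMarcinkiewiczMultiplier K) (n : ℕ) (hn : 3 ≤ n) (hodd : Odd n) :
    BilinearMultiplier.IsMarcinkiewiczMultiplier
      (BilinearMultiplier.radialKernel (EuclideanSpace ℝ (Fin n)) K) := by
  -- Positive dimension makes the space nontrivial, so a unit vector `e` exists.
  have : NeZero n := ⟨by omega⟩
  exact hK.radialKernel (EuclideanSpace ℝ (Fin n))
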